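/- Let $M$ be an $n$-dimensional $C^\infty$-manifold (Hausdorff, second countable, without boundary), let $S=\{1,\dots,k\}$, and let $D=\{u_i : i\in S\}$ be smooth, forward complete vector fields on $M$. Let $\lambda_i>0$ for $i\in S$, and for each $i\in S$ let $(p_{ij})_{j\in S}$ be a probability vector with $p_{ii}=0$ and $p_{ij}>0$ for all $j\neq i$. Let $(X,A)=(X_t,A_t)_{t\ge 0}$ be the Markov process on $M\times S$ that, started at $(\xi,i)$, follows the trajectory of $u_i$ from $\xi$ for an exponentially distributed time with parameter $\lambda_i$, then selects a new regime $j$ with probability $p_{ij}$, follows $u_j$ for an exponentially distributed time with parameter $\lambda_j$, and so on; the times between switches are independent conditionally on the sequence of regimes. Here $X_t$ is the position and $A_t$ the current regime at time $t$, and $\mathsf P^t_{\xi,i}$ denotes the law of $(X_t,A_t)$ for the process started at $(\xi,i)$. A probability measure $\mu$ on $M\times S$ is invariant if $\int_{M\times S} \mathsf P^t_{x}(B)\,\mu(dx)=\mu(B)$ for all $t\ge 0$ and all measurable $B$. An invariant $\mu$ is ergodic if $\mu(B)\in\{0,1\}$ for every measurable set $B$ such that, for every $t\ge0$, $\mathsf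 P^t_x(B)=1$ for $\mu$-almost every $x\in B$. Let $\mathcal I(D)$ be the smallest Lie algebra of smooth vector fields on $M$ containing $D$, let $\mathcal I'(D)$ be the smallest Lie algebra containing all brackets $[v,w]$ with $v,w\in\mathcal I(D)$, and let $\mathcal I_0(D)$ be the set of vector fields $v+\sum_{i=1}^k c_iu_i$ with $v\in\mathcal I'(D)$, $c_i\in\mathbb R$ and $\sum_{i=1}^k c_i=0$. A point $\eta\in M$ satisfies Condition A if $\dim\{u(\eta):u\in\mathcal I_0(D)\}=n$. Let $\lambda^M$ be a Lebesgue measure on $M$, i.e. a Borel measure whose pushforward under any smooth chart is equivalent to Lebesgue measure on the image of the chart; the Lebesgue measure on $M\times S$ is the product of $\lambda^M$ and counting measure. Theorem. Let $\mu$ be an ergodic invariant measure for $(\mathsf P^t)_{t\ge0}$. Assume that the support of $\mu$ contains a point $(\eta,i)$ such that Condition A holds at $\eta$. Then $\mu$ is absolutely continuous with respect to the Lebesgue measure on $M\times S$. -/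

import Mathlib

open MeasureTheory ProbabilityTheory
open scoped Manifold ContDiff Topology

noncomputable section

namespace Switching

/-! ### Smooth vector fields and their Lie algebra -/

/-- Smooth vector fields on the `n`-dimensional manifold `M`. -/
abbrev SmoothVectorField (n : ℕ) (M : Type*) [TopologicalSpace M]
    [ChartedSpace (EuclideanSpace ℝ (Fin n)) M] [IsManifold (𝓡 n) ∞ M] : Type _ :=
  Cₛ^∞⟮𝓡 n; EuclideanSpace ℝ (Fin n), (TangentSpace (𝓡 n) : M → Type)⟯

section Lie

variable {n : ℕ} {M : Type*} [TopologicalSpace M]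
  [ChartedSpace (EuclideanSpace ℝ (Fin n)) M] [IsManifold (𝓡 n) ∞ M]

theorem contMDiff_mlieBracket (v w : SmoothVectorField n M) :
    ContMDiff (𝓡 n) (𝓡 n).tangent ∞
      (fun x => (⟨x, VectorField.mlieBracket (𝓡 n) v w x⟩ : TangentBundle (𝓡 n) M)) := by
  have : IsManifold (𝓡 n) (((⊤ : ℕ∞) : ℕ∞ω) + 1) M := by
    have h : (((⊤ : ℕ∞) : ℕ∞ω) + 1) = ∞ := rfl
    rw [h]; infer_instance
  have : IsManifold (𝓡 n) (minSmoothness ℝ 2) M := by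
    rw [minSmoothness_of_isRCLikeNormedField]; infer_instance
  intro x
  exact ContMDiffAt.mlieBracket_vectorField (m := ⊤) (n := ⊤) (v.contMDiff x) (w.contMDiff x)
    (by simp)

instance : Bracket (SmoothVectorField n M) (SmoothVectorField n M) where
  bracket v w := ⟨VectorField.mlieBracket (𝓡 n) v w, contMDiff_mlieBracket v w⟩

theorem bracket_apply (v w : SmoothVectorField n M) (x : M) :
    ⁅v, w⁆ x = VectorField.mlieBracket (𝓡 n) v w x := rfl

/-- Smooth vector fields form a real Lie algebra under the Lie bracket. -/
instance : LieRing (SmoothVectorField n M) where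
  add_lie u v w := by
    ext1 x
    exact VectorField.mlieBracket_add_left u.mdifferentiableAt v.mdifferentiableAt
  lie_add u v w := by
    ext1 x
    exact VectorField.mlieBracket_add_right v.mdifferentiableAt w.mdifferentiableAt
  lie_self u := by
    ext1 x
    exact congrFun VectorField.mlieBracket_self x
  leibniz_lie u v w := by
    have : IsManifold (𝓡 n) (minSmoothness ℝ 3) M := by
      rw [minSmoothness_of_isRCLikeNormedField]; infer_instance
    have hs : ∀ z : SmoothVectorField n M, ContMDiff (𝓡 n) (𝓡 n).tangent (minSmoothness ℝ 2)
        (fun x => (⟨x, z x⟩ : TangentBundle (𝓡 n) M)) := fun z =>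
      z.contMDiff.of_le (by rw [minSmoothness_of_isRCLikeNormedField]; exact ENat.LEInfty.out)
    ext1 x
    exact VectorField.leibniz_identity_mlieBracket_apply (hs u x) (hs v x) (hs w x)

instance : LieAlgebra ℝ (SmoothVectorField n M) where
  lie_smul c v w := by
    ext1 x
    exact VectorField.mlieBracket_const_smul_right w.mdifferentiableAt

/-- Evaluation of vector fields at a point, as a linear map. -/
def evalAt (ξ : M) : SmoothVectorField n M →ₗ[ℝ] TangentSpace (𝓡 n) ξ where
  toFun v := v ξ
  map_add' _ _ := rfl
  map_smul' _ _ := rfl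

variable {k : ℕ}

/-- `𝓘(D)`: the smallest Lie subalgebra of vector fields containing `D = {u_1, …, u_k}`. -/
def lieHull (u : Fin k → SmoothVectorField n M) : LieSubalgebra ℝ (SmoothVectorField n M) :=
  LieSubalgebra.lieSpan ℝ _ (Set.range u)

/-- `𝓘'(D)`: the smallest Lie subalgebra containing all brackets of elements of `𝓘(D)`. -/
def derivedHull (u : Fin k → SmoothVectorField n M) : LieSubalgebra ℝ (SmoothVectorField n M) :=
  LieSubalgebra.lieSpan ℝ _ {w | ∃ v₁ ∈ lieHull u, ∃ v₂ ∈ lieHull u, w = ⁅v₁, v₂⁆}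

/-- `𝓘₀(D)`: the vector fields `v + ∑ cᵢ uᵢ` with `v ∈ 𝓘'(D)` and `∑ cᵢ = 0`. -/
def zeroHull (u : Fin k → SmoothVectorField n M) : Submodule ℝ (SmoothVectorField n M) where
  carrier := {w | ∃ v ∈ derivedHull u, ∃ c : Fin k → ℝ, ∑ i, c i = 0 ∧ w = v + ∑ i, c i • u i}
  zero_mem' := ⟨0, zero_mem _, 0, by simp, by simp⟩
  add_mem' := by
    rintro _ _ ⟨v, hv, c, hc, rfl⟩ ⟨v', hv', c', hc', rfl⟩
    refine ⟨v + v', add_mem hv hv', c + c', ?_, ?_⟩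
    · simp [Finset.sum_add_distrib, hc, hc']
    · simp only [Pi.add_apply, add_smul, Finset.sum_add_distrib]; abel
  smul_mem' := by
    rintro a _ ⟨v, hv, c, hc, rfl⟩
    refine ⟨a • v, (derivedHull u).smul_mem a hv, a • c, ?_, ?_⟩
    · simp [← Finset.mul_sum, hc]
    · simp only [Pi.smul_apply, smul_eq_mul, mul_smul, smul_add, Finset.smul_sum]

/-- Condition A at `ξ`: `dim 𝓘₀(D)(ξ) = n`. -/
def ConditionA (u : Fin k → SmoothVectorField n M) (ξ : M) : Prop :=
  Module.finrank ℝ ((zeroHull u).map (evalAt ξ)) = n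

/-! ### Forward flows -/

/-- Every point is the starting point of an integral curve defined on `[0, ∞)`. -/
def IsForwardComplete (v : SmoothVectorField n M) : Prop :=
  ∀ ξ : M, ∃ γ : ℝ → M, γ 0 = ξ ∧ IsMIntegralCurveOn γ (fun x => v x) (Set.Ici 0)

open Classical in
/-- The forward flow: for `t ≥ 0`, the position at time `t` of the integral curve started at `ξ`
(for `t < 0` it is frozen at `ξ`; only `t ≥ 0` matters below). -/
def flow (v : SmoothVectorField n M) (t : ℝ) (ξ : M) : M :=
  if h : ∃ γ : ℝ → M, γ 0 = ξ ∧ IsMIntegralCurveOn γ (fun x => v x) (Set.Ici 0) then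
    h.choose (max t 0)
  else ξ

end Lie

/-! ### The switching process -/

/-- The data of a randomly switched system on `M` with regimes `Fin k`. -/
structure SwitchingSystem (n k : ℕ) (M : Type*) [TopologicalSpace M]
    [ChartedSpace (EuclideanSpace ℝ (Fin n)) M] [IsManifold (𝓡 n) ∞ M] where
  /-- the driving vector fields `u_i` -/
  field : Fin k → SmoothVectorField n M
  /-- the vector fields are forward complete -/
  forwardComplete : ∀ i, IsForwardComplete (field i)
  /-- the parameter `λ_i` of the exponential holding time in regime `i` -/
  rate : Fin k → ℝ
  rate_pos : ∀ i, 0 < rate i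
  /-- the law of the regime selected when regime `i` is left -/
  next : Fin k → PMF (Fin k)
  /-- the new regime is selected from the other regimes … -/
  next_self : ∀ i, next i i = 0
  /-- … each of them with positive probability -/
  next_pos : ∀ i j, i ≠ j → 0 < next i j

namespace SwitchingSystem

variable {n k : ℕ} {M : Type*} [TopologicalSpace M]
  [ChartedSpace (EuclideanSpace ℝ (Fin n)) M] [IsManifold (𝓡 n) ∞ M]

/-- The law of the driving noise `noise`. All coordinates are independent; the pair `noise (m, i)` holds
an exponential time with parameter `λ_i` and, independently, a new regime with law `next i`. It is
used at the `m`-th step of the procedure if the regime at that step is `i`. -/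
def noiseLaw (sys : SwitchingSystem n k M) : Measure (ℕ × Fin k → ℝ × Fin k) :=
  Measure.infinitePi fun q => (expMeasure (sys.rate q.2)).prod (sys.next q.2).toMeasure

/-- The regime after `m` switches, starting from `i`. -/
def regimeSeq (i : Fin k) (noise : ℕ × Fin k → ℝ × Fin k) : ℕ → Fin k
  | 0 => i
  | m + 1 => (noise (m, regimeSeq i noise m)).2

/-- The time spent in the regime following the `m`-th switch. -/
def holdingTime (i : Fin k) (noise : ℕ × Fin k → ℝ × Fin k) (m : ℕ) : ℝ :=
  (noise (m, regimeSeq i noise m)).1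

/-- The time of the `m`-th switch (and `0` for `m = 0`). -/
def switchTime (i : Fin k) (noise : ℕ × Fin k → ℝ × Fin k) (m : ℕ) : ℝ :=
  ∑ l ∈ Finset.range m, holdingTime i noise l

/-- The position at the time of the `m`-th switch, starting from `ξ`. -/
def positionSeq (sys : SwitchingSystem n k M) (ξ : M) (i : Fin k)
    (noise : ℕ × Fin k → ℝ × Fin k) : ℕ → M
  | 0 => ξ
  | m + 1 => flow (sys.field (regimeSeq i noise m)) (holdingTime i noise m) (positionSeq sys ξ i noise m)

/-- The number of switches up to time `t`: the `m` with `switchTime m ≤ t < switchTime (m + 1)`.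
(Almost surely the holding times are positive with infinite sum, so that it is well defined.) -/
def numSwitches (i : Fin k) (t : ℝ) (noise : ℕ × Fin k → ℝ × Fin k) : ℕ :=
  sInf {m | t < switchTime i noise (m + 1)}

/-- The regime `A_t`. -/
def regimeAt (i : Fin k) (t : ℝ) (noise : ℕ × Fin k → ℝ × Fin k) : Fin k :=
  regimeSeq i noise (numSwitches i t noise)

/-- The position `X_t`. -/
def positionAt (sys : SwitchingSystem n k M) (ξ : M) (i : Fin k) (t : ℝ)
    (noise : ℕ × Fin k → ℝ × Fin k) : M :=
  flow (sys.field (regimeAt i t noise)) (t - switchTime i noise (numSwitches i t noise))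
    (positionSeq sys ξ i noise (numSwitches i t noise))

variable [MeasurableSpace M]

/-- The transition probability `P^t_{ξ,i}`: the law of `(X_t, A_t)` for the process started at
`x = (ξ, i)`. -/
def transition (sys : SwitchingSystem n k M) (t : ℝ) (x : M × Fin k) : Measure (M × Fin k) :=
  sys.noiseLaw.map fun noise => (sys.positionAt x.1 x.2 t noise, regimeAt x.2 t noise)

/-- `μ P^t = μ` for all `t ≥ 0`. -/
def IsInvariant (sys : SwitchingSystem n k M) (μ : Measure (M × Fin k)) : Prop :=
  ∀ t : ℝ, 0 ≤ t → ∀ B : Set (M × Fin k), MeasurableSet B →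
    ∫⁻ x, sys.transition t x B ∂μ = μ B

/-- `B` is `μ`-invariant: for every `t ≥ 0`, `P^t_x(B) = 1` for `μ`-almost every `x ∈ B`. -/
def IsInvariantSet (sys : SwitchingSystem n k M) (μ : Measure (M × Fin k))
    (B : Set (M × Fin k)) : Prop :=
  ∀ t : ℝ, 0 ≤ t → ∀ᵐ x ∂μ, x ∈ B → sys.transition t x B = 1

/-- An invariant probability measure is ergodic if its invariant measurable sets are trivial. -/
structure IsErgodic (sys : SwitchingSystem n k M) (μ : Measure (M × Fin k)) : Prop where
  isProbabilityMeasure : IsProbabilityMeasure μ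
  isInvariant : sys.IsInvariant μ
  trivial_of_isInvariantSet : ∀ B : Set (M × Fin k), MeasurableSet B →
    sys.IsInvariantSet μ B → μ B = 1 ∨ μ B = 0

end SwitchingSystem

/-! ### Lebesgue measure on a manifold -/

/-- A Borel measure on `M` is a Lebesgue measure if its pushforward under any chart of the
maximal smooth atlas is equivalent to (the restriction of) Lebesgue measure. -/
def IsLebesgueMeasure (n : ℕ) {M : Type*} [TopologicalSpace M]
    [ChartedSpace (EuclideanSpace ℝ (Fin n)) M] [MeasurableSpace M] (ν : Measure M) : Prop :=
  ∀ e ∈ IsManifold.maximalAtlas (𝓡 n) ∞ M,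
    (ν.restrict e.source).map e ≪ volume.restrict e.target ∧
      volume.restrict e.target ≪ (ν.restrict e.source).map e

section Existence

variable {n : ℕ} {M : Type*} [TopologicalSpace M]
  [ChartedSpace (EuclideanSpace ℝ (Fin n)) M]

theorem volume_transition_eq_zero {e c : OpenPartialHomeomorph M (EuclideanSpace ℝ (Fin n))}
    (he : e ∈ IsManifold.maximalAtlas (𝓡 n) ∞ M) (hc : c ∈ IsManifold.maximalAtlas (𝓡 n) ∞ M)
    {B : Set M} (hB : B ⊆ e.source ∩ c.source) (h0 : volume (e '' B) = 0) :
    volume (c '' B) = 0 := by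
  have h1 : ContDiffOn ℝ ∞ (e.symm.trans c) (e.symm.trans c).source := by
    have h := (contDiffGroupoid ∞ (𝓡 n)).compatible_of_mem_maximalAtlas he hc
    exact contMDiffOn_iff_contDiffOn.1 (contMDiffOn_of_mem_contDiffGroupoid h)
  have h2 : c '' B = (e.symm.trans c) '' (e '' B) := by
    rw [Set.image_image]
    refine Set.image_congr fun x hx => ?_
    simp [e.left_inv (hB hx).1]
  rw [h2]
  refine addHaar_image_eq_zero_of_differentiableOn_of_addHaar_eq_zero volume ?_ h0
  refine (h1.differentiableOn (by simp)).mono ?_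
  rintro _ ⟨x, hx, rfl⟩
  simp [e.left_inv (hB hx).1, e.map_source (hB hx).1, (hB hx).2]

/-- Lebesgue measures exist. -/
theorem exists_isLebesgueMeasure [SecondCountableTopology M] [IsManifold (𝓡 n) ∞ M]
    [MeasurableSpace M] [BorelSpace M] : ∃ ν : Measure M, IsLebesgueMeasure n ν := by
  obtain ⟨s, hs, hcov⟩ := TopologicalSpace.countable_cover_nhds
    (fun x : M => chart_source_mem_nhds (EuclideanSpace ℝ (Fin n)) x)
  have := hs.to_subtype
  let c : s → OpenPartialHomeomorph M (EuclideanSpace ℝ (Fin n)) := fun x => chartAt _ x.1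
  have hc : ∀ x, c x ∈ IsManifold.maximalAtlas (𝓡 n) ∞ M := fun x =>
    IsManifold.chart_mem_maximalAtlas x.1
  refine ⟨Measure.sum fun x : s => (volume.restrict (c x).target).map (c x).symm, fun e he => ?_⟩
  have key : ∀ B : Set M, MeasurableSet B → B ⊆ e.source →
      ((Measure.sum fun x : s => (volume.restrict (c x).target).map (c x).symm) B = 0 ↔
        volume (e '' B) = 0) := by
    intro B hB hBe
    have hval : ∀ x, (volume.restrict (c x).target).map (c x).symm B
        = volume (c x '' (B ∩ (c x).source)) := by
      intro x
      have hm : AEMeasurable (c x).symm (volume.restrict (c x).target) :=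
        (c x).continuousOn_symm.aemeasurable (c x).open_target.measurableSet
      rw [Measure.map_apply_of_aemeasurable hm hB,
        Measure.restrict_apply' (c x).open_target.measurableSet]
      congr 1
      rw [Set.inter_comm B, (c x).image_source_inter_eq', Set.inter_comm]
    rw [Measure.sum_apply_eq_zero' hB]
    simp only [hval]
    constructor
    · intro h
      have hU : e '' B = ⋃ x, e '' (B ∩ (c x).source) := by
        rw [← Set.image_iUnion, ← Set.inter_iUnion]
        have : ⋃ x, (c x).source = Set.univ := by
          rw [← hcov, Set.biUnion_eq_iUnion]
        rw [this, Set.inter_univ]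
      rw [hU]
      exact measure_iUnion_null fun x => volume_transition_eq_zero (hc x) he
        (fun y hy => ⟨hy.2, hBe hy.1⟩) (h x)
    · intro h x
      exact volume_transition_eq_zero he (hc x) (fun y hy => ⟨hBe hy.1, hy.2⟩)
        (measure_mono_null (Set.image_mono Set.inter_subset_left) h)
  have hpush : ∀ A : Set (EuclideanSpace ℝ (Fin n)), MeasurableSet A →
      ((((Measure.sum fun x : s => (volume.restrict (c x).target).map (c x).symm).restrict
        e.source).map e) A = 0 ↔ volume.restrict e.target A = 0) := by
    intro A hA
    have hm : AEMeasurable e ((Measure.sum fun x : s =>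
        (volume.restrict (c x).target).map (c x).symm).restrict e.source) :=
      e.continuousOn.aemeasurable e.open_source.measurableSet
    rw [Measure.map_apply_of_aemeasurable hm hA,
      Measure.restrict_apply' e.open_source.measurableSet,
      Measure.restrict_apply' e.open_target.measurableSet, Set.inter_comm, key]
    · have h : e '' (e.source ∩ e ⁻¹' A) = e.target ∩ A := by
        ext y
        constructor
        · rintro ⟨x, ⟨hx, hxA⟩, rfl⟩
          exact ⟨e.map_source hx, hxA⟩
        · rintro ⟨hy, hyA⟩
          exact ⟨e.symm y, ⟨e.map_target hy, by simpa [e.right_inv hy] using hyA⟩, e.right_inv hy⟩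
      rw [h, Set.inter_comm A]
    · have h := e.continuousOn.domRestrict.measurable hA
      have h2 := e.open_source.measurableSet.subtype_image h
      convert h2 using 1
      ext x
      simp [and_comm]
    · exact Set.inter_subset_left
  exact ⟨Measure.AbsolutelyContinuous.mk fun A hA h => (hpush A hA).2 h,
    Measure.AbsolutelyContinuous.mk fun A hA h => (hpush A hA).1 h⟩

end Existence

end Switching

end

/-! An ergodic measure is of pure type. Since flow maps pull Lebesgue null sets back to null sets,
the carrier of the absolutely continuous part of `μ` is an invariant set. Ergodicity then leaves two
cases: `μ` is absolutely continuous, or it is carried by a Lebesgue null set `N`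
(`IsErgodic.absolutelyContinuous_or_singular`).

Condition A rules out the second case (`IsInvariant.measure_compl_ne_zero`). Invariance lets `N` be
shrunk to a set `G`, still of full measure, with an absorbing property: from `(ξ, i)` in `G`,
following `u_i` for time `s` and then `u_j` for time `r` leads to `G` in regime `j`, for almost all
`s` and `r` (`exists_absorbing_subset`). This uses that exponential times have positive density and
that every change of regime has positive probability.

As `(η, i)` lies in the support, `G` has a point near `η`, possibly in another regime. From it one
grows immersed patches of dimension `0, 1, …, n`, almost all of whose points are in `G` with a
common regime. While the dimension is below `n`, some `u_l` is not tangent to the patch somewhere: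
otherwise the whole generated Lie algebra would be tangent, whereas Condition A makes it span an
`n`-dimensional space near `η` (`IsPatch.exists_notMem_range`). Flowing the patch for a short fixed
time along its current field and then for a variable time along `u_l` adds a dimension
(`IsPatch.exists_extension`).

A patch of dimension `n` is parametrized by a local diffeomorphism, so it cannot lie almost entirely
in the null set `N`. -/

noncomputable section

namespace Switching

universe u

/-! ### Superposition operators on spaces of continuous curves. -/

section Superposition

variable {E F : Type*} [NormedAddCommGroup E] [NormedSpace ℝ E]
  [NormedAddCommGroup F] [NormedSpace ℝ F]

/-- Evaluation of a curve of operators on a curve of vectors, as a continuous linear map. -/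
def pointwiseApply (E F : Type*) [NormedAddCommGroup E] [NormedSpace ℝ E]
    [NormedAddCommGroup F] [NormedSpace ℝ F] :
    C(unitInterval, E →L[ℝ] F) →L[ℝ] C(unitInterval, E) →L[ℝ] C(unitInterval, F) :=
  LinearMap.mkContinuous₂
    (LinearMap.mk₂ ℝ (fun (A : C(unitInterval, E →L[ℝ] F)) (h : C(unitInterval, E)) =>
        (⟨fun t => A t (h t), by fun_prop⟩ : C(unitInterval, F)))
      (fun _ _ _ => by ext; simp) (fun _ _ _ => by ext; simp)
      (fun _ _ _ => by ext; simp) (fun _ _ _ => by ext; simp)) 1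
    (fun A h => by
      rw [one_mul]
      refine (ContinuousMap.norm_le _ (by positivity)).2 fun t => ?_
      exact (A t).le_of_opNorm_le_of_le (A.norm_coe_le_norm t) (h.norm_coe_le_norm t))

/-- The mean value inequality at each time gives the estimate, and it is uniform in time because
composition with the derivative of `f` is continuous in the supremum norm. -/
theorem hasFDerivAt_superposition {f : E → F} (hf : ContDiff ℝ 1 f) (γ : C(unitInterval, E)) :
    HasFDerivAt (fun γ : C(unitInterval, E) => (⟨f, hf.continuous⟩ : C(E, F)).comp γ)
      (pointwiseApply E F ((⟨fderiv ℝ f, hf.continuous_fderiv one_ne_zero⟩ :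
        C(E, E →L[ℝ] F)).comp γ)) γ := by
  set D : C(E, E →L[ℝ] F) := ⟨fderiv ℝ f, hf.continuous_fderiv one_ne_zero⟩ with hD
  have hcont := (ContinuousMap.continuous_postcomp (X := unitInterval) D).continuousAt (x := γ)
  rw [hasFDerivAt_iff_isLittleO_nhds_zero, Asymptotics.isLittleO_iff]
  intro c hc
  obtain ⟨δ, hδ, hball⟩ := (Metric.tendsto_nhds_nhds (f := fun x : C(unitInterval, E) => D.comp x)
    (a := γ) (b := D.comp γ)).1 hcont c hc
  filter_upwards [Metric.ball_mem_nhds (0 : C(unitInterval, E)) hδ] with h hh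
  rw [mem_ball_zero_iff] at hh
  refine (ContinuousMap.norm_le _ (by positivity)).2 fun t => ?_
  have hbound : ∀ y ∈ Metric.closedBall (γ t) ‖h t‖,
      ‖fderiv ℝ f y - fderiv ℝ f (γ t)‖ ≤ c := by
    intro y hy
    -- The translate of `γ` by `y - γ t` passes through `y` at time `t` and is within `‖h‖` of `γ`,
    -- so closeness of curves controls the derivative at the single point `y`.
    have h1 := hball (x := γ + ContinuousMap.const _ (y - γ t)) (by
      rw [dist_eq_norm, add_sub_cancel_left]
      refine lt_of_le_of_lt ((ContinuousMap.norm_le _ (norm_nonneg h)).2 fun s => ?_) hh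
      simpa [dist_eq_norm] using (mem_closedBall_iff_norm.1 hy).trans (h.norm_coe_le_norm t))
    have h2 := (ContinuousMap.dist_apply_le_dist (f := D.comp (γ + ContinuousMap.const _ (y - γ t)))
      (g := D.comp γ) t).trans h1.le
    simpa [hD, dist_eq_norm] using h2
  have hmv := (convex_closedBall (γ t) ‖h t‖).norm_image_sub_le_of_norm_hasFDerivWithin_le'
    (f := f) (f' := fderiv ℝ f) (φ := fderiv ℝ f (γ t)) (C := c) (x := γ t) (y := γ t + h t)
    (fun y _ => (hf.differentiable one_ne_zero y).hasFDerivAt.hasFDerivWithinAt) hbound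
    (by simp) (by simp)
  rw [add_sub_cancel_left] at hmv
  refine le_trans ?_ (hmv.trans (mul_le_mul_of_nonneg_left (h.norm_coe_le_norm t) hc.le))
  exact le_of_eq rfl

/-- The derivative of superposition with `f` is a continuous linear map applied to superposition
with `fderiv ℝ f`. The induction therefore varies the target `F`, which forces a common universe. -/
theorem contDiff_superposition_nat {E : Type u} [NormedAddCommGroup E] [NormedSpace ℝ E] (m : ℕ) :
    ∀ {F : Type u} [NormedAddCommGroup F] [NormedSpace ℝ F] {f : E → F} (hf : ContDiff ℝ ∞ f),
    ContDiff ℝ m (fun γ : C(unitInterval, E) => (⟨f, hf.continuous⟩ : C(E, F)).comp γ) := by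
  induction m with
  | zero =>
    intro F _ _ f hf
    exact contDiff_zero.2 (ContinuousMap.continuous_postcomp _)
  | succ m ih =>
    intro F _ _ f hf
    have h1 : ContDiff ℝ 1 f := hf.of_le (by simp)
    push_cast
    refine contDiff_succ_iff_hasFDerivAt.2 ⟨_, ?_, fun γ => hasFDerivAt_superposition h1 γ⟩
    have hlin : ContDiff ℝ m (fun A : C(unitInterval, E →L[ℝ] F) => pointwiseApply E F A) := by
      fun_prop
    exact hlin.comp (ih (contDiff_infty_iff_fderiv.1 hf).2)

/-- Superposition with a smooth map is smooth on spaces of continuous curves. -/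
theorem contDiff_superposition {E F : Type u} [NormedAddCommGroup E] [NormedSpace ℝ E]
    [NormedAddCommGroup F] [NormedSpace ℝ F] {f : E → F} (hf : ContDiff ℝ ∞ f) :
    ContDiff ℝ ∞ (fun γ : C(unitInterval, E) => (⟨f, hf.continuous⟩ : C(E, F)).comp γ) :=
  contDiff_infty.2 fun m => contDiff_superposition_nat m hf

/-- The primitive vanishing at `0`, as an operator on continuous curves. -/
def primitive (E : Type*) [NormedAddCommGroup E] [NormedSpace ℝ E] [CompleteSpace E] :
    C(unitInterval, E) →L[ℝ] C(unitInterval, E) :=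
  LinearMap.mkContinuous
    { toFun := fun γ => ⟨fun t => ∫ τ in (0 : ℝ)..t, γ (Set.projIcc 0 1 zero_le_one τ), by
        have : Continuous fun τ : ℝ => γ (Set.projIcc 0 1 zero_le_one τ) :=
          γ.continuous.comp continuous_projIcc
        exact (intervalIntegral.continuous_primitive
          (fun a b => this.intervalIntegrable a b) 0).comp continuous_subtype_val⟩
      map_add' := fun γ γ' => by
        have h : ∀ γ : C(unitInterval, E), Continuous fun τ : ℝ => γ (Set.projIcc 0 1 zero_le_one τ) :=
          fun γ => γ.continuous.comp continuous_projIcc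
        ext t
        exact intervalIntegral.integral_add ((h γ).intervalIntegrable _ _)
          ((h γ').intervalIntegrable _ _)
      map_smul' := fun c γ => by
        ext t
        exact intervalIntegral.integral_smul _ _ } 1 (fun γ => by
      rw [one_mul]
      refine (ContinuousMap.norm_le _ (norm_nonneg _)).2 fun t => ?_
      refine (intervalIntegral.norm_integral_le_of_norm_le_const (C := ‖γ‖)
        fun τ _ => γ.norm_coe_le_norm _).trans ?_
      rw [sub_zero, abs_of_nonneg t.2.1]
      exact mul_le_of_le_one_right (norm_nonneg _) t.2.2)

theorem primitive_apply [CompleteSpace E] (γ : C(unitInterval, E)) (t : unitInterval) :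
    primitive E γ t = ∫ τ in (0 : ℝ)..t, γ (Set.projIcc 0 1 zero_le_one τ) := rfl

end Superposition

/-! ### Smooth local flows from the inverse function theorem. -/

section LocalFlow

variable {E : Type u} [NormedAddCommGroup E] [NormedSpace ℝ E] [CompleteSpace E]

/-- The fixed point equation of the initial value problem on a rescaled time interval. -/
theorem exists_contDiffOn_rescaled_solution {v : E → E} (hv : ContDiff ℝ ∞ v) (x₀ : E) :
    ∃ O : Set (ℝ × E), IsOpen O ∧ (0, x₀) ∈ O ∧ ∃ ψ : ℝ × E → C(unitInterval, E),
      ContDiffOn ℝ ∞ ψ O ∧ ψ (0, x₀) = ContinuousMap.const _ x₀ ∧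
      ∀ q ∈ O, ψ q = ContinuousMap.const _ q.2 +
        q.1 • primitive E ((⟨v, hv.continuous⟩ : C(E, E)).comp (ψ q)) := by
  set N : C(unitInterval, E) → C(unitInterval, E) := fun γ => (⟨v, hv.continuous⟩ : C(E, E)).comp γ
    with hN
  have hNs : ContDiff ℝ ∞ N := contDiff_superposition hv
  let K : E →L[ℝ] C(unitInterval, E) :=
    LinearMap.mkContinuous ⟨⟨fun x => ContinuousMap.const _ x, fun _ _ => rfl⟩, fun _ _ => rfl⟩ 1
      (fun x => by
        rw [one_mul]
        exact (ContinuousMap.norm_le _ (norm_nonneg _)).2 fun t => le_rfl)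
  -- The second component vanishes exactly when `γ t = x + s ∫₀ᵗ v (γ τ) dτ`, which is the
  -- differential equation with time rescaled by `s` to the unit interval.
  set H : (ℝ × E) × C(unitInterval, E) → (ℝ × E) × C(unitInterval, E) :=
    fun p => (p.1, p.2 - (K p.1.2 + p.1.1 • primitive E (N p.2))) with hH
  have hHs : ContDiff ℝ ∞ H := by
    refine contDiff_fst.prodMk (contDiff_snd.sub ((K.contDiff.comp
      (contDiff_snd.comp contDiff_fst)).add ((contDiff_fst.comp contDiff_fst).smul
        ((primitive E).contDiff.comp (hNs.comp contDiff_snd)))))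
  set a : (ℝ × E) × C(unitInterval, E) := ((0, x₀), ContinuousMap.const _ x₀) with ha
  let A : (ℝ × E) →L[ℝ] C(unitInterval, E) :=
    -(K.comp (ContinuousLinearMap.snd ℝ ℝ E) +
      (ContinuousLinearMap.fst ℝ ℝ E).smulRight (primitive E (N a.2)))
  -- At `s = 0` the term with the derivative of `N` drops out, so the derivative of `H` is a shear
  -- and is invertible.
  let H' : ((ℝ × E) × C(unitInterval, E)) ≃L[ℝ] ((ℝ × E) × C(unitInterval, E)) :=
    (ContinuousLinearEquiv.refl ℝ (ℝ × E)).skewProd (ContinuousLinearEquiv.refl ℝ _) A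
  have hder : HasFDerivAt H (H' : _ →L[ℝ] _) a := by
    have hP : HasFDerivAt (fun p : (ℝ × E) × C(unitInterval, E) => primitive E (N p.2))
        (((primitive E).comp (fderiv ℝ N a.2)).comp (ContinuousLinearMap.snd ℝ _ _)) a :=
      ((primitive E).hasFDerivAt.comp a.2
        ((hNs.differentiable (by simp)) a.2).hasFDerivAt).comp a hasFDerivAt_snd
    have hs : HasFDerivAt (fun p : (ℝ × E) × C(unitInterval, E) => p.1.1)
        ((ContinuousLinearMap.fst ℝ ℝ E).comp (ContinuousLinearMap.fst ℝ _ _)) a :=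
      (ContinuousLinearMap.hasFDerivAt (ContinuousLinearMap.fst ℝ ℝ E)).comp a hasFDerivAt_fst
    have hx : HasFDerivAt (fun p : (ℝ × E) × C(unitInterval, E) => K p.1.2)
        ((K.comp (ContinuousLinearMap.snd ℝ ℝ E)).comp (ContinuousLinearMap.fst ℝ _ _)) a :=
      (ContinuousLinearMap.hasFDerivAt (K.comp (ContinuousLinearMap.snd ℝ ℝ E))).comp a
        hasFDerivAt_fst
    have := (hasFDerivAt_fst (𝕜 := ℝ) (p := a)).prodMk
      ((hasFDerivAt_snd (𝕜 := ℝ) (p := a)).sub (hx.add (hs.smul hP)))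
    refine this.congr_fderiv ?_
    ext p <;> simp [H', A, ha]
  have hHa : ContDiffAt ℝ ∞ H a := hHs.contDiffAt
  set φ := hHa.toOpenPartialHomeomorph H hder (by simp) with hφ
  have hφH : ∀ p, φ p = H p := fun p => rfl
  have haφ : a ∈ φ.source := hHa.mem_toOpenPartialHomeomorph_source hder (by simp)
  have hHa0 : H a = ((0, x₀), 0) := by
    simp [hH, ha]
    exact sub_self _
  -- the region where the derivative is invertible
  set R : Set ((ℝ × E) × C(unitInterval, E)) :=
    (fderiv ℝ H) ⁻¹' Set.range (ContinuousLinearEquiv.toContinuousLinearMap :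
      (((ℝ × E) × C(unitInterval, E)) ≃L[ℝ] ((ℝ × E) × C(unitInterval, E))) → _) with hR
  have hRo : IsOpen R := (ContinuousLinearEquiv.isOpen (𝕜 := ℝ)).preimage
    (hHs.continuous_fderiv (by simp))
  have haR : a ∈ R := ⟨H', hder.fderiv.symm⟩
  have hT : IsOpen (φ.target ∩ φ.symm ⁻¹' R) := φ.isOpen_inter_preimage_symm hRo
  set ι : ℝ × E → (ℝ × E) × C(unitInterval, E) := fun q => (q, 0) with hι
  have hιc : ContDiff ℝ ∞ ι := contDiff_id.prodMk contDiff_const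
  have hφa : φ.symm ((0, x₀), 0) = a := by rw [← hHa0, ← hφH, φ.left_inv haφ]
  refine ⟨ι ⁻¹' (φ.target ∩ φ.symm ⁻¹' R), hT.preimage hιc.continuous, ?_,
    fun q => (φ.symm (ι q)).2, ?_, ?_, ?_⟩
  · refine ⟨?_, ?_⟩
    · have := φ.map_source haφ
      rwa [hφH, hHa0] at this
    · change φ.symm ((0, x₀), 0) ∈ R
      rw [hφa]; exact haR
  · intro q hq
    obtain ⟨L, hL⟩ := hq.2
    have h1 : ContDiffAt ℝ ∞ φ.symm (ι q) := by
      refine φ.contDiffAt_symm (f₀' := L) hq.1 ?_ hHs.contDiffAt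
      rw [hL]
      exact (hHs.differentiable (by simp) _).hasFDerivAt
    exact (contDiff_snd.contDiffAt.comp q (h1.comp q hιc.contDiffAt)).contDiffWithinAt
  · change (φ.symm ((0, x₀), 0)).2 = _
    rw [hφa]
  · intro q hq
    have h1 : H (φ.symm (ι q)) = ι q := by rw [← hφH, φ.right_inv hq.1]
    have h2 : (φ.symm (ι q)).1 = q := congrArg Prod.fst h1
    have h3 := congrArg Prod.snd h1
    have h4 := sub_eq_zero.1 h3
    rw [h2] at h4
    exact h4

/-- Smooth dependence of solutions of autonomous differential equations on short times and on
initial values. -/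
theorem exists_contDiffOn_localFlow {v : E → E} (hv : ContDiff ℝ ∞ v) (x₀ : E) {W : Set E}
    (hW : W ∈ 𝓝 x₀) :
    ∃ O : Set (ℝ × E), IsOpen O ∧ (0, x₀) ∈ O ∧ ∃ Ψ : ℝ × E → E,
      ContDiffOn ℝ ∞ Ψ O ∧ (∀ y, (0, y) ∈ O → HasDerivAt (fun s => Ψ (s, y)) (v y) 0) ∧
      ∀ s y, (s, y) ∈ O → 0 ≤ s → ∃ β : ℝ → E, β 0 = y ∧ β s = Ψ (s, y) ∧
        ∀ σ ∈ Set.Icc 0 s, β σ ∈ W ∧ HasDerivAt β (v (β σ)) σ := by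
  obtain ⟨O, hO, h0, ψ, hψ, hψ0, hfix⟩ := exists_contDiffOn_rescaled_solution hv x₀
  obtain ⟨r, hr, hrW⟩ := Metric.mem_nhds_iff.1 hW
  have hpre : IsOpen (O ∩ ψ ⁻¹' Metric.ball (ContinuousMap.const _ x₀) r) :=
    hψ.continuousOn.isOpen_inter_preimage hO Metric.isOpen_ball
  have heval : ∀ t : unitInterval, ContDiff ℝ ∞ fun γ : C(unitInterval, E) => γ t :=
    fun t => (ContinuousMap.evalCLM (M := E) ℝ t).contDiff
  refine ⟨_, hpre, ⟨h0, by simp [hψ0, hr]⟩, fun q => ψ q 1, ?_, ?_, ?_⟩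
  · exact (heval 1).comp_contDiffOn (hψ.mono Set.inter_subset_left)
  · intro y hy
    -- The endpoint of the rescaled solution is `y + s • k s` with `k` continuous at `0`, so its
    -- derivative in `s` at `0` is `k 0 = v y`.
    set k : ℝ → E := fun s => primitive E ((⟨v, hv.continuous⟩ : C(E, E)).comp (ψ (s, y))) 1
    have hψy : ψ (0, y) = ContinuousMap.const _ y := by
      have := hfix _ hy.1
      simpa using this
    have hk0 : k 0 = v y := by
      simp [k, hψy, primitive_apply]
    have hev : (fun s => ψ (s, y) 1) =ᶠ[𝓝 0] fun s => y + s • k s := by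
      have : ∀ᶠ s : ℝ in 𝓝 0, (s, y) ∈ O :=
        (Continuous.prodMk_left y).continuousAt.eventually (hO.mem_nhds hy.1)
      filter_upwards [this] with s hs
      conv_lhs => rw [hfix _ hs]
      rfl
    have hkc : ContinuousAt k 0 := by
      have h1 : ContinuousAt (fun s : ℝ => ψ (s, y)) 0 :=
        ContinuousAt.comp (f := fun s : ℝ => (s, y)) (x := (0 : ℝ))
          (hψ.continuousOn.continuousAt (hO.mem_nhds hy.1))
          (Continuous.prodMk_left y).continuousAt
      have h2 : Continuous fun γ : C(unitInterval, E) =>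
          primitive E ((⟨v, hv.continuous⟩ : C(E, E)).comp γ) 1 :=
        (heval 1).continuous.comp ((primitive E).continuous.comp
          (ContinuousMap.continuous_postcomp _))
      exact h2.continuousAt.comp h1
    have hd : HasDerivAt (fun s : ℝ => s • k s) (v y) 0 := by
      rw [hasDerivAt_iff_tendsto_slope_zero]
      rw [← hk0]
      refine (hkc.tendsto.mono_left nhdsWithin_le_nhds).congr' ?_
      filter_upwards [self_mem_nhdsWithin] with t ht
      simp [smul_smul, inv_mul_cancel₀ (Set.mem_compl_singleton_iff.1 ht)]
    exact (hd.const_add y).congr_of_eventuallyEq hev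
  · rintro s y ⟨hsy, hball⟩ hs
    have hmemW : ∀ t, ψ (s, y) t ∈ W := fun t => hrW (by
      have := (ContinuousMap.dist_apply_le_dist (f := ψ (s, y)) (g := ContinuousMap.const _ x₀) t)
      exact lt_of_le_of_lt this hball)
    -- For `s = 0` the rescaling degenerates and only time `0` matters, so a straight line serves.
    -- For `s > 0` the integral formula defines the curve for all times, which makes it
    -- differentiable from both sides at the endpoints.
    rcases hs.eq_or_lt with rfl | hs
    · have hψy : ψ (0, y) = ContinuousMap.const _ y := by
        have := hfix _ hsy
        simpa using this
      refine ⟨fun σ => y + σ • v y, by simp, by simp [hψy], ?_⟩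
      intro σ hσ
      obtain rfl : σ = 0 := le_antisymm hσ.2 hσ.1
      refine ⟨by simpa [hψy] using hmemW 0, ?_⟩
      simpa using ((hasDerivAt_id (0 : ℝ)).smul_const (v y)).const_add y
    · have hg : Continuous fun τ : ℝ => v (ψ (s, y) (Set.projIcc 0 1 zero_le_one τ)) :=
        hv.continuous.comp ((ψ (s, y)).continuous.comp continuous_projIcc)
      set β : ℝ → E := fun σ => y + s • ∫ τ in (0 : ℝ)..σ / s,
        v (ψ (s, y) (Set.projIcc 0 1 zero_le_one τ)) with hβ
      have hval : ∀ σ ∈ Set.Icc 0 s, β σ = ψ (s, y) (Set.projIcc 0 1 zero_le_one (σ / s)) := by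
        intro σ hσ
        have hmem : σ / s ∈ Set.Icc (0 : ℝ) 1 := ⟨div_nonneg hσ.1 hs.le, (div_le_one hs).2 hσ.2⟩
        conv_rhs => rw [hfix _ hsy]
        simp [hβ, primitive_apply, Set.projIcc_of_mem zero_le_one hmem]
      refine ⟨β, by simp [hβ], ?_, fun σ hσ => ?_⟩
      · rw [hval s ⟨hs.le, le_rfl⟩, div_self hs.ne']
        simp
      · rw [hval σ hσ]
        refine ⟨hmemW _, ?_⟩
        have h1 := intervalIntegral.integral_hasDerivAt_right
          (hg.intervalIntegrable 0 (σ / s)) (hg.stronglyMeasurableAtFilter _ _) hg.continuousAt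
        have h2 := (h1.scomp σ ((hasDerivAt_id σ).div_const s)).const_smul s |>.const_add y
        refine h2.congr_deriv ?_
        simp [smul_smul, mul_inv_cancel₀ hs.ne']

end LocalFlow

/-! ### Null sets under local diffeomorphisms. -/

section NullPreimage

variable {E : Type*} [NormedAddCommGroup E] [NormedSpace ℝ E] [FiniteDimensional ℝ E]
  [MeasurableSpace E] [BorelSpace E]

/-- Preimages of null sets under local diffeomorphisms are null. -/
theorem addHaar_inter_preimage_eq_zero (ν : Measure E) [ν.IsAddHaarMeasure] {f : E → E} {O : Set E}
    (hO : IsOpen O) (hf : ContDiffOn ℝ 1 f O) (hinj : ∀ x ∈ O, Function.Injective (fderiv ℝ f x))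
    {A : Set E} (hA : ν A = 0) : ν (O ∩ f ⁻¹' A) = 0 := by
  -- Near each point of `O` there is a `C¹` local inverse, and differentiable maps send null sets to
  -- null sets.
  refine measure_null_of_locally_null _ fun x hx => ?_
  have hcd : ContDiffAt ℝ 1 f x := hf.contDiffAt (hO.mem_nhds hx.1)
  let L : E ≃L[ℝ] E := (LinearEquiv.ofInjectiveEndo (fderiv ℝ f x : E →ₗ[ℝ] E)
    (hinj x hx.1)).toContinuousLinearEquiv
  have hd : HasFDerivAt f (L : E →L[ℝ] E) x := by
    have : (L : E →L[ℝ] E) = fderiv ℝ f x := by ext y; rfl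
    rw [this]
    exact (hcd.differentiableAt one_ne_zero).hasFDerivAt
  set φ := hcd.toOpenPartialHomeomorph f hd one_ne_zero with hφ
  have hxφ : x ∈ φ.source := hcd.mem_toOpenPartialHomeomorph_source hd one_ne_zero
  have hinv : ContDiffAt ℝ 1 φ.symm (f x) := by
    refine φ.contDiffAt_symm (f₀' := L) (φ.map_source hxφ) ?_ ?_
    · convert! hd
      exact φ.left_inv hxφ
    · convert! hcd
      exact φ.left_inv hxφ
  obtain ⟨u, hu, hdu⟩ := hinv.contDiffOn (m := 1) le_rfl (by simp)
  obtain ⟨w, hwu, hwo, hfw⟩ := mem_nhds_iff.1 hu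
  have hS : φ.source ∩ f ⁻¹' w ∈ 𝓝 x :=
    Filter.inter_mem (φ.open_source.mem_nhds hxφ) (hcd.continuousAt.preimage_mem_nhds
      (hwo.mem_nhds hfw))
  refine ⟨(O ∩ f ⁻¹' A) ∩ (φ.source ∩ f ⁻¹' w),
    Filter.inter_mem self_mem_nhdsWithin (mem_nhdsWithin_of_mem_nhds hS), ?_⟩
  refine measure_mono_null (t := φ.symm '' (w ∩ A)) ?_ ?_
  · rintro z ⟨⟨_, hzA⟩, hzφ, hzw⟩
    exact ⟨f z, ⟨hzw, hzA⟩, φ.left_inv hzφ⟩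
  · refine addHaar_image_eq_zero_of_differentiableOn_of_addHaar_eq_zero ν ?_
      (measure_mono_null Set.inter_subset_right hA)
    exact (hdu.differentiableOn one_ne_zero).mono (Set.inter_subset_left.trans hwu)

end NullPreimage

/-! ### Vector fields and integral curves read in charts. -/

section ChartField

variable {n : ℕ} {M : Type*} [TopologicalSpace M]
  [ChartedSpace (EuclideanSpace ℝ (Fin n)) M] [IsManifold (𝓡 n) ∞ M]
  {e : OpenPartialHomeomorph M (EuclideanSpace ℝ (Fin n))}

/-- The representation of a vector field in a chart. -/
def chartField (e : OpenPartialHomeomorph M (EuclideanSpace ℝ (Fin n)))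
    (v : SmoothVectorField n M) : EuclideanSpace ℝ (Fin n) → EuclideanSpace ℝ (Fin n) :=
  VectorField.mpullback 𝓘(ℝ, EuclideanSpace ℝ (Fin n)) (𝓡 n) e.symm v

theorem mdifferentiable_chart_of_mem_atlas (he : e ∈ atlas (EuclideanSpace ℝ (Fin n)) M) :
    e.MDifferentiable (𝓡 n) (𝓡 n) := by
  have : IsManifold (𝓡 n) 1 M := .of_le (n := ∞) (by simp)
  exact mdifferentiable_of_mem_atlas he

theorem isInvertible_mfderiv_chart_symm (he : e ∈ atlas (EuclideanSpace ℝ (Fin n)) M)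
    {y : EuclideanSpace ℝ (Fin n)} (hy : y ∈ e.target) :
    (mfderiv (𝓡 n) (𝓡 n) e.symm y).IsInvertible :=
  ⟨(mdifferentiable_chart_of_mem_atlas he).symm.mfderiv hy, rfl⟩

theorem mfderiv_chart_symm_chartField (he : e ∈ atlas (EuclideanSpace ℝ (Fin n)) M)
    (v : SmoothVectorField n M) {y : EuclideanSpace ℝ (Fin n)} (hy : y ∈ e.target) :
    mfderiv (𝓡 n) (𝓡 n) e.symm y (chartField e v y) = v (e.symm y) := by
  obtain ⟨L, hL⟩ := isInvertible_mfderiv_chart_symm he hy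
  rw [chartField, VectorField.mpullback_apply, ← hL, ContinuousLinearMap.inverse_equiv]
  exact L.apply_symm_apply _

theorem contMDiffOn_chart_symm (he : e ∈ atlas (EuclideanSpace ℝ (Fin n)) M) :
    ContMDiffOn (𝓡 n) (𝓡 n) ∞ e.symm e.target :=
  contMDiffOn_symm_of_mem_maximalAtlas (IsManifold.subset_maximalAtlas he)

theorem contDiffOn_chartField (he : e ∈ atlas (EuclideanSpace ℝ (Fin n)) M)
    (v : SmoothVectorField n M) : ContDiffOn ℝ ∞ (chartField e v) e.target := by
  have : IsManifold (𝓡 n) 1 M := .of_le (n := ∞) (by simp)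
  intro y hy
  have h : ContMDiffAt (𝓡 n) (𝓡 n) ∞ e.symm y :=
    (contMDiffOn_chart_symm he).contMDiffAt (e.open_target.mem_nhds hy)
  have h2 := ContMDiffAt.mpullback_vectorField_preimage (m := ∞) (n := ∞) (v.contMDiff (e.symm y)) h
    (isInvertible_mfderiv_chart_symm he hy) (by simp)
  exact (contMDiffAt_vectorSpace_iff_contDiffAt.1 h2).contDiffWithinAt

theorem chartField_bracket (he : e ∈ atlas (EuclideanSpace ℝ (Fin n)) M)
    (v w : SmoothVectorField n M) {y : EuclideanSpace ℝ (Fin n)} (hy : y ∈ e.target) :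
    chartField e ⁅v, w⁆ y = VectorField.lieBracket ℝ (chartField e v) (chartField e w) y := by
  have : IsManifold (𝓡 n) (minSmoothness ℝ 3) M := by
    rw [minSmoothness_of_isRCLikeNormedField]; infer_instance
  have h : ContMDiffAt (𝓡 n) (𝓡 n) ∞ e.symm y :=
    (contMDiffOn_chart_symm he).contMDiffAt (e.open_target.mem_nhds hy)
  have := VectorField.mpullback_mlieBracket (I := 𝓡 n) (I' := 𝓡 n) (n := ∞) (f := e.symm) (x₀ := y)
    (V := v) (W := w) v.mdifferentiableAt w.mdifferentiableAt h
    (by rw [minSmoothness_of_isRCLikeNormedField]; exact ENat.LEInfty.out)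
  refine this.trans ?_
  rw [← VectorField.mlieBracketWithin_univ, VectorField.mlieBracketWithin_eq_lieBracketWithin]
  exact congrFun (VectorField.lieBracketWithin_univ (𝕜 := ℝ) (V := chartField e v)
    (W := chartField e w)) y

theorem chartField_add (v w : SmoothVectorField n M) :
    chartField e (v + w) = chartField e v + chartField e w :=
  VectorField.mpullback_add

theorem chartField_smul (c : ℝ) (v : SmoothVectorField n M) :
    chartField e (c • v) = c • chartField e v :=
  VectorField.mpullback_const_smul

theorem chartField_zero : chartField e (0 : SmoothVectorField n M) = 0 :=
  VectorField.mpullback_zero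

theorem hasMFDerivWithinAt_chart_symm_comp (he : e ∈ atlas (EuclideanSpace ℝ (Fin n)) M)
    (v : SmoothVectorField n M) {β : ℝ → EuclideanSpace ℝ (Fin n)} {s : Set ℝ} {t : ℝ}
    (hβ : HasDerivWithinAt β (chartField e v (β t)) s t) (ht : β t ∈ e.target) :
    HasMFDerivWithinAt 𝓘(ℝ, ℝ) (𝓡 n) (e.symm ∘ β) s t
      ((1 : ℝ →L[ℝ] ℝ).smulRight (v ((e.symm ∘ β) t))) := by
  have h1 := ((mdifferentiable_chart_of_mem_atlas he).mdifferentiableAt_symm ht).hasMFDerivAt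
  have h2 : HasMFDerivWithinAt 𝓘(ℝ, ℝ) (𝓡 n) β s t
    ((1 : ℝ →L[ℝ] ℝ).smulRight (chartField e v (β t))) := hβ.hasFDerivWithinAt.hasMFDerivWithinAt
  have h3 := h1.comp_hasMFDerivWithinAt t h2
  have key : ∀ r : ℝ,
      mfderiv (𝓡 n) (𝓡 n) e.symm (β t) (r • chartField e v (β t)) = r • v (e.symm (β t)) :=
    fun r => ((mfderiv (𝓡 n) (𝓡 n) e.symm (β t)).map_smul r _).trans
      (congrArg (r • ·) (mfderiv_chart_symm_chartField he v ht))
  exact h3.congr_mfderiv (ContinuousLinearMap.ext fun r => key r)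

theorem hasDerivWithinAt_chart_comp (he : e ∈ atlas (EuclideanSpace ℝ (Fin n)) M)
    (v : SmoothVectorField n M) {γ : ℝ → M} {s : Set ℝ} {t : ℝ}
    (hγ : HasMFDerivWithinAt 𝓘(ℝ, ℝ) (𝓡 n) γ s t ((1 : ℝ →L[ℝ] ℝ).smulRight (v (γ t))))
    (ht : γ t ∈ e.source) :
    HasDerivWithinAt (e ∘ γ) (chartField e v ((e ∘ γ) t)) s t := by
  have hmd := mdifferentiable_chart_of_mem_atlas he
  have h1 := (hmd.mdifferentiableAt ht).hasMFDerivAt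
  have h3 : HasFDerivWithinAt (e ∘ γ) ((1 : ℝ →L[ℝ] ℝ).smulRight (chartField e v (e (γ t)))) s t := by
    have h4 := mfderiv_chart_symm_chartField he v (e.map_source ht)
    have h5 := hmd.comp_symm_deriv (e.map_source ht)
    rw [e.left_inv ht] at h4 h5
    have h6 := DFunLike.congr_fun h5 (chartField e v (e (γ t)))
    have key : ∀ r : ℝ, mfderiv (𝓡 n) (𝓡 n) e (γ t) (r • v (γ t)) = r • chartField e v (e (γ t)) :=
      fun r => by
        rw [map_smul, ← h4]
        exact congrArg (r • ·) h6
    exact hasMFDerivWithinAt_iff_hasFDerivWithinAt.1 ((h1.comp_hasMFDerivWithinAt t hγ).congr_mfderiv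
      (ContinuousLinearMap.ext fun r => key r))
  have h7 := h3.hasDerivWithinAt
  rwa [ContinuousLinearMap.smulRight_apply, one_apply_eq_self, one_smul] at h7

end ChartField

/-! ### Uniqueness of integral curves and the forward flow. -/

section Flow

variable {n : ℕ} {M : Type*} [TopologicalSpace M]
  [ChartedSpace (EuclideanSpace ℝ (Fin n)) M] [IsManifold (𝓡 n) ∞ M]
  {v : SmoothVectorField n M}

/-- Integral curves on `[0, T]` are determined by their starting points. -/
theorem integralCurve_eqOn_Icc [T2Space M] {γ γ' : ℝ → M} {T : ℝ}
    (hγ : IsMIntegralCurveOn γ (fun x => v x) (Set.Icc 0 T))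
    (hγ' : IsMIntegralCurveOn γ' (fun x => v x) (Set.Icc 0 T)) (h0 : γ 0 = γ' 0) :
    Set.EqOn γ γ' (Set.Icc 0 T) := by
  have hclosed : IsClosed ({t | γ t = γ' t} ∩ Set.Icc 0 T) := by
    rw [Set.inter_comm]
    exact (hγ.continuousOn.prodMk hγ'.continuousOn).preimage_isClosed_of_isClosed isClosed_Icc
      isClosed_diagonal
  -- Continuous induction: the set of times of agreement is closed, and from such a time agreement
  -- extends a little to the right by uniqueness for a Lipschitz field in a chart.
  refine hclosed.Icc_subset_of_forall_exists_gt h0 ?_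
  rintro t ⟨heq : γ t = γ' t, ht⟩ y (hy : t < y)
  set e := chartAt (EuclideanSpace ℝ (Fin n)) (γ t) with he_def
  have he : e ∈ atlas (EuclideanSpace ℝ (Fin n)) M := chart_mem_atlas _ _
  have hsrc : γ t ∈ e.source := mem_chart_source _ _
  have hcd : ContDiffAt ℝ 1 (chartField e v) (e (γ t)) :=
    ((contDiffOn_chartField he v).contDiffAt (e.open_target.mem_nhds (e.map_source hsrc))).of_le
      (by simp)
  obtain ⟨K, w, hw, hlip⟩ := hcd.exists_lipschitzOnWith
  have hle : 𝓝[≥] t ≤ 𝓝[Set.Icc 0 T] t :=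
    nhdsWithin_le_of_mem (Icc_mem_nhdsGE_of_mem ht)
  have hnear : ∀ {δ : ℝ → M}, IsMIntegralCurveOn δ (fun x => v x) (Set.Icc 0 T) → δ t = γ t →
      ∀ᶠ τ in 𝓝[≥] t, δ τ ∈ e.source ∧ e (δ τ) ∈ w := by
    intro δ hδ hδt
    have h1 : Filter.Tendsto δ (𝓝[≥] t) (𝓝 (γ t)) := by
      rw [← hδt]
      exact (hδ.continuousWithinAt ⟨ht.1, ht.2.le⟩).mono_left hle
    exact h1 (Filter.inter_mem (e.open_source.mem_nhds hsrc)
      ((e.continuousAt hsrc).preimage_mem_nhds hw))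
  have hev : ∀ᶠ τ in 𝓝[≥] t, (γ τ ∈ e.source ∧ e (γ τ) ∈ w) ∧
      (γ' τ ∈ e.source ∧ e (γ' τ) ∈ w) ∧ τ ∈ Set.Icc 0 T :=
    (hnear hγ rfl).and ((hnear hγ' heq.symm).and (Icc_mem_nhdsGE_of_mem ht))
  obtain ⟨b, hb, hsub⟩ := mem_nhdsGE_iff_exists_Icc_subset.1
    (Filter.inter_mem hev (Icc_mem_nhdsGE hy))
  have hbT : ∀ τ ∈ Set.Icc t b, τ ∈ Set.Icc 0 T := fun τ hτ => (hsub hτ).1.2.2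
  have hder : ∀ {δ : ℝ → M}, IsMIntegralCurveOn δ (fun x => v x) (Set.Icc 0 T) →
      (∀ τ ∈ Set.Icc t b, δ τ ∈ e.source) → ∀ τ ∈ Set.Icc t b,
      HasDerivWithinAt (e ∘ δ) (chartField e v ((e ∘ δ) τ)) (Set.Icc 0 T) τ :=
    fun hδ hs τ hτ => hasDerivWithinAt_chart_comp he v (hδ τ (hbT τ hτ)) (hs τ hτ)
  have hcont : ∀ {δ : ℝ → M}, IsMIntegralCurveOn δ (fun x => v x) (Set.Icc 0 T) →
      (∀ τ ∈ Set.Icc t b, δ τ ∈ e.source) → ContinuousOn (e ∘ δ) (Set.Icc t b) :=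
    fun hδ hs τ hτ => (hder hδ hs τ hτ).continuousWithinAt.mono hbT
  have hright : ∀ {δ : ℝ → M}, IsMIntegralCurveOn δ (fun x => v x) (Set.Icc 0 T) →
      (∀ τ ∈ Set.Icc t b, δ τ ∈ e.source) → ∀ τ ∈ Set.Ico t b,
      HasDerivWithinAt (e ∘ δ) (chartField e v ((e ∘ δ) τ)) (Set.Ici τ) τ :=
    fun hδ hs τ hτ => (hder hδ hs τ ⟨hτ.1, hτ.2.le⟩).mono_of_mem_nhdsWithin
      (Icc_mem_nhdsGE_of_mem ⟨(hbT τ ⟨hτ.1, hτ.2.le⟩).1,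
        hτ.2.trans_le (hbT b ⟨(Set.mem_Ioi.1 hb).le, le_rfl⟩).2⟩)
  have hs1 : ∀ τ ∈ Set.Icc t b, γ τ ∈ e.source := fun τ hτ => (hsub hτ).1.1.1
  have hs2 : ∀ τ ∈ Set.Icc t b, γ' τ ∈ e.source := fun τ hτ => (hsub hτ).1.2.1.1
  have hEq := ODE_solution_unique_of_mem_Icc_right (v := fun _ => chartField e v) (s := fun _ => w)
    (K := K) (a := t) (b := b) (f := e ∘ γ) (g := e ∘ γ') (fun _ _ => hlip) (hcont hγ hs1)
    (hright hγ hs1) (fun τ hτ => (hsub ⟨hτ.1, hτ.2.le⟩).1.1.2) (hcont hγ' hs2)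
    (hright hγ' hs2) (fun τ hτ => (hsub ⟨hτ.1, hτ.2.le⟩).1.2.1.2) (congrArg e heq)
  have hbb : b ∈ Set.Icc t b := ⟨(Set.mem_Ioi.1 hb).le, le_rfl⟩
  exact ⟨b, e.injOn (hs1 b hbb) (hs2 b hbb) (hEq hbb), hb, (hsub hbb).2.2⟩

theorem flow_spec (hv : IsForwardComplete v) (ξ : M) :
    flow v 0 ξ = ξ ∧ IsMIntegralCurveOn (fun t => flow v t ξ) (fun x => v x) (Set.Ici 0) := by
  have h := hv ξ
  have hfl : ∀ t, flow v t ξ = h.choose (max t 0) := fun t => by rw [flow, dif_pos h]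
  have hpos : ∀ t ∈ Set.Ici (0 : ℝ), flow v t ξ = h.choose t := fun t ht => by
    rw [hfl, max_eq_left ht]
  refine ⟨(hpos 0 Set.self_mem_Ici).trans h.choose_spec.1, fun t ht => ?_⟩
  have h1 := h.choose_spec.2 t ht
  rw [← hpos t ht] at h1
  exact h1.congr_of_eventuallyEq (Filter.eventually_of_mem self_mem_nhdsWithin hpos) (hpos t ht)

theorem flow_zero (hv : IsForwardComplete v) (ξ : M) : flow v 0 ξ = ξ := (flow_spec hv ξ).1

/-- The flow is frozen at negative times, so statements about all real times reduce to nonnegative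
ones. -/
theorem flow_max (t : ℝ) (ξ : M) : flow v (max t 0) ξ = flow v t ξ := by
  unfold flow
  split_ifs with h
  · rw [max_eq_left (le_max_right t 0)]
  · rfl

theorem flow_eq_of_integralCurve [T2Space M] (hv : IsForwardComplete v) {γ : ℝ → M} {T : ℝ}
    (hγ : IsMIntegralCurveOn γ (fun x => v x) (Set.Icc 0 T)) {t : ℝ} (ht : t ∈ Set.Icc 0 T) :
    flow v t (γ 0) = γ t :=
  integralCurve_eqOn_Icc ((flow_spec hv (γ 0)).2.mono Set.Icc_subset_Ici_self) hγ
    (flow_zero hv _) ht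

theorem flow_add [T2Space M] (hv : IsForwardComplete v) {s t : ℝ} (hs : 0 ≤ s) (ht : 0 ≤ t)
    (ξ : M) : flow v (s + t) ξ = flow v s (flow v t ξ) := by
  have h := ((flow_spec hv ξ).2.comp_add t).mono (s' := Set.Icc 0 s)
    fun τ hτ => add_nonneg hτ.1 ht
  have := flow_eq_of_integralCurve hv h (t := s) ⟨hs, le_rfl⟩
  simpa using this.symm

/-- The representation of a forward flow in a chart, for short times. -/
theorem exists_localFlow_chart [T2Space M] (hv : IsForwardComplete v)
    {e : OpenPartialHomeomorph M (EuclideanSpace ℝ (Fin n))}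
    (he : e ∈ atlas (EuclideanSpace ℝ (Fin n)) M) {y₀ : EuclideanSpace ℝ (Fin n)}
    (hy₀ : y₀ ∈ e.target) :
    ∃ O : Set (ℝ × EuclideanSpace ℝ (Fin n)), IsOpen O ∧ (0, y₀) ∈ O ∧
      ∃ Ψ : ℝ × EuclideanSpace ℝ (Fin n) → EuclideanSpace ℝ (Fin n), ContDiffOn ℝ ∞ Ψ O ∧
      (∀ y, (0, y) ∈ O → Ψ (0, y) = y ∧ HasDerivAt (fun s => Ψ (s, y)) (chartField e v y) 0) ∧
      (∀ q ∈ O, q.2 ∈ e.target ∧ Ψ q ∈ e.target) ∧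
      ∀ s y, (s, y) ∈ O → 0 ≤ s → flow v s (e.symm y) = e.symm (Ψ (s, y)) := by
  obtain ⟨r, hr, hball⟩ := Metric.nhds_basis_closedBall.mem_iff.1 (e.open_target.mem_nhds hy₀)
  -- The cutoff turns the chart field into a smooth field on the whole space, to which the local
  -- theory applies. The two fields agree on the ball of radius `r / 2`, where the solutions are
  -- required to stay.
  let f : ContDiffBump y₀ := ⟨r / 2, r, by positivity, by linarith⟩
  set w : EuclideanSpace ℝ (Fin n) → EuclideanSpace ℝ (Fin n) := fun y => f y • chartField e v y
    with hw_def
  have hw : ContDiff ℝ ∞ w := by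
    rw [contDiff_iff_contDiffAt]
    intro y
    by_cases hy : y ∈ e.target
    · exact f.contDiff.contDiffAt.smul ((contDiffOn_chartField he v).contDiffAt
        (e.open_target.mem_nhds hy))
    · have hy' : y ∉ tsupport f := fun h => hy (hball (f.tsupport_eq ▸ h))
      have hz : w =ᶠ[𝓝 y] fun _ => 0 := by
        filter_upwards [notMem_tsupport_iff_eventuallyEq.1 hy'] with z hz
        simp [hw_def, hz]
      exact contDiffAt_const.congr_of_eventuallyEq hz
  have hweq : ∀ y ∈ Metric.ball y₀ (r / 2), w y = chartField e v y := fun y hy => by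
    rw [hw_def]
    simp only
    rw [f.one_of_mem_closedBall (Metric.ball_subset_closedBall hy), one_smul]
  have hbt : ∀ y ∈ Metric.ball y₀ (r / 2), y ∈ e.target := fun y hy =>
    hball (Metric.ball_subset_closedBall (Metric.ball_subset_ball (by linarith) hy))
  obtain ⟨O, hO, h0, Ψ, hΨ, hder, hcurve⟩ := exists_contDiffOn_localFlow hw y₀
    (Metric.ball_mem_nhds y₀ (half_pos hr))
  have hΨ0 : ∀ y, (0, y) ∈ O → Ψ (0, y) = y := fun y hy => by
    obtain ⟨β, hβ0, hβs, -⟩ := hcurve 0 y hy le_rfl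
    rw [← hβs, hβ0]
  have hO2 : IsOpen (O ∩ (Prod.snd ⁻¹' Metric.ball y₀ (r / 2))) :=
    hO.inter (Metric.isOpen_ball.preimage continuous_snd)
  refine ⟨_, (hΨ.continuousOn.mono Set.inter_subset_left).isOpen_inter_preimage hO2 e.open_target,
    ⟨⟨h0, Metric.mem_ball_self (half_pos hr)⟩, by
      rw [Set.mem_preimage, hΨ0 _ h0]; exact hy₀⟩, Ψ,
    hΨ.mono (Set.inter_subset_left.trans Set.inter_subset_left), ?_, ?_, ?_⟩
  · intro y hy
    refine ⟨hΨ0 y hy.1.1, ?_⟩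
    rw [← hweq y hy.1.2]
    exact hder y hy.1.1
  · exact fun q hq => ⟨hbt _ hq.1.2, hq.2⟩
  · intro s y hq hs
    obtain ⟨β, hβ0, hβs, hβ⟩ := hcurve s y hq.1.1 hs
    have hint : IsMIntegralCurveOn (e.symm ∘ β) (fun x => v x) (Set.Icc 0 s) := fun σ hσ => by
      have := (hβ σ hσ).2
      rw [hweq _ (hβ σ hσ).1] at this
      exact hasMFDerivWithinAt_chart_symm_comp he v this.hasDerivWithinAt (hbt _ (hβ σ hσ).1)
    have := flow_eq_of_integralCurve hv hint (t := s) ⟨hs, le_rfl⟩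
    simpa [hβ0, hβs] using this

end Flow

/-! ### Null sets of Lebesgue measures on the manifold. -/

section LebesgueNull

variable {n : ℕ} {M : Type*} [TopologicalSpace M]
  [ChartedSpace (EuclideanSpace ℝ (Fin n)) M] [IsManifold (𝓡 n) ∞ M]
  [MeasurableSpace M] [BorelSpace M] {lambdaM : Measure M}
  {e : OpenPartialHomeomorph M (EuclideanSpace ℝ (Fin n))}

/-- Equivalence of measures compares measurable sets only; passing to measurable hulls covers
arbitrary `A`, so that images and flow preimages can be used without measurability checks. -/
theorem IsLebesgueMeasure.null_iff_of_subset_source (hl : IsLebesgueMeasure n lambdaM)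
    (he : e ∈ atlas (EuclideanSpace ℝ (Fin n)) M) {A : Set M} (hA : A ⊆ e.source) :
    lambdaM A = 0 ↔ volume (e '' A) = 0 := by
  obtain ⟨h1, h2⟩ := hl e (IsManifold.subset_maximalAtlas he)
  have hm : AEMeasurable e (lambdaM.restrict e.source) :=
    e.continuousOn.aemeasurable e.open_source.measurableSet
  constructor
  · intro h
    set T := toMeasurable lambdaM A
    have hT : MeasurableSet (e.target ∩ e.symm ⁻¹' T) := by
      have h := e.symm.continuousOn.domRestrict.measurable (measurableSet_toMeasurable lambdaM A)
      have h2 := e.open_target.measurableSet.subtype_image h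
      convert h2 using 1
      ext x
      simp [T, and_comm]
    have h3 : (volume.restrict e.target) (e.target ∩ e.symm ⁻¹' T) = 0 := by
      refine h2 ?_
      rw [Measure.map_apply_of_aemeasurable hm hT,
        Measure.restrict_apply' e.open_source.measurableSet]
      refine measure_mono_null (t := T) ?_ ((measure_toMeasurable A).trans h)
      rintro x ⟨⟨-, hx⟩, hxs⟩
      rwa [Set.mem_preimage, e.left_inv hxs] at hx
    rw [Measure.restrict_apply' e.open_target.measurableSet] at h3
    refine measure_mono_null ?_ h3
    rintro _ ⟨x, hx, rfl⟩
    refine ⟨⟨e.map_source (hA hx), ?_⟩, e.map_source (hA hx)⟩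
    rw [Set.mem_preimage, e.left_inv (hA hx)]
    exact subset_toMeasurable _ _ hx
  · intro h
    set V := toMeasurable volume (e '' A)
    have h3 : ((lambdaM.restrict e.source).map e) V = 0 :=
      h1 (Measure.absolutelyContinuous_of_le Measure.restrict_le_self
        ((measure_toMeasurable (e '' A)).trans h))
    rw [Measure.map_apply_of_aemeasurable hm (measurableSet_toMeasurable _ _),
      Measure.restrict_apply' e.open_source.measurableSet] at h3
    refine measure_mono_null ?_ h3
    exact fun x hx => ⟨subset_toMeasurable volume (e '' A) (Set.mem_image_of_mem e hx), hA hx⟩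

/-- A Lebesgue measure has the null sets of some s-finite measure. -/
theorem IsLebesgueMeasure.exists_sFinite [SecondCountableTopology M]
    (hl : IsLebesgueMeasure n lambdaM) :
    ∃ ν : Measure M, SFinite ν ∧ ∀ A, MeasurableSet A → (ν A = 0 ↔ lambdaM A = 0) := by
  obtain ⟨s, hs, hcov⟩ := TopologicalSpace.countable_cover_nhds
    (fun x : M => chart_source_mem_nhds (EuclideanSpace ℝ (Fin n)) x)
  have := hs.to_subtype
  let c : s → OpenPartialHomeomorph M (EuclideanSpace ℝ (Fin n)) := fun x => chartAt _ x.1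
  -- A Lebesgue measure itself need not be s-finite, which Fubini arguments require; a countable sum
  -- of transported chart measures is.
  refine ⟨Measure.sum fun x : s => (volume.restrict (c x).target).map (c x).symm, inferInstance,
    fun A hA => ?_⟩
  have hval : ∀ x, (volume.restrict (c x).target).map (c x).symm A = 0 ↔
      lambdaM (A ∩ (c x).source) = 0 := by
    intro x
    have hm : AEMeasurable (c x).symm (volume.restrict (c x).target) :=
      (c x).continuousOn_symm.aemeasurable (c x).open_target.measurableSet
    rw [Measure.map_apply_of_aemeasurable hm hA,
      Measure.restrict_apply' (c x).open_target.measurableSet,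
      hl.null_iff_of_subset_source (chart_mem_atlas _ x.1) Set.inter_subset_right,
      Set.inter_comm A, (c x).image_source_inter_eq', Set.inter_comm]
  rw [Measure.sum_apply_eq_zero' hA]
  simp only [hval]
  constructor
  · intro h
    have hU : A = ⋃ x, A ∩ (c x).source := by
      rw [← Set.inter_iUnion]
      have : ⋃ x, (c x).source = Set.univ := by
        rw [← hcov, Set.biUnion_eq_iUnion]
      rw [this, Set.inter_univ]
    rw [hU]
    exact measure_iUnion_null h
  · exact fun h x => measure_mono_null Set.inter_subset_left h

end LebesgueNull

/-! ### Continuity and nonsingularity of flow maps at all times. -/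

section GlobalFlow

variable {n : ℕ} {M : Type*} [TopologicalSpace M] [T2Space M]
  [ChartedSpace (EuclideanSpace ℝ (Fin n)) M] [IsManifold (𝓡 n) ∞ M]
  [MeasurableSpace M] [BorelSpace M] {lambdaM : Measure M}
  {v : SmoothVectorField n M}

/-- In a chart the spatial derivative of the flow is the identity at time `0`. It stays invertible
on a product neighbourhood, so short-time flow maps are local diffeomorphisms there, with a uniform
time bound `ε`. -/
theorem exists_nhds_flow_shortTime (hl : IsLebesgueMeasure n lambdaM) (hv : IsForwardComplete v)
    (x : M) : ∃ U : Set M, IsOpen U ∧ x ∈ U ∧ ∃ ε > 0,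
      ContinuousOn (fun q : ℝ × M => flow v q.1 q.2) (Set.Ico 0 ε ×ˢ U) ∧
      ∀ s ∈ Set.Ico 0 ε, ∀ A, lambdaM A = 0 → lambdaM (U ∩ flow v s ⁻¹' A) = 0 := by
  set e := chartAt (EuclideanSpace ℝ (Fin n)) x with he_def
  have he : e ∈ atlas (EuclideanSpace ℝ (Fin n)) M := chart_mem_atlas _ _
  have hsrc : x ∈ e.source := mem_chart_source _ _
  obtain ⟨O, hO, h0, Ψ, hΨ, hΨ0, htgt, hflow⟩ := exists_localFlow_chart hv he (e.map_source hsrc)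
  set D : ℝ × EuclideanSpace ℝ (Fin n) → EuclideanSpace ℝ (Fin n) →L[ℝ] EuclideanSpace ℝ (Fin n) :=
    fun q => (fderiv ℝ Ψ q).comp (ContinuousLinearMap.inr ℝ ℝ _) with hD
  have hΨd : ∀ q ∈ O, HasFDerivAt (fun y => Ψ (q.1, y)) (D q) q.2 := fun q hq =>
    (((hΨ.contDiffAt (hO.mem_nhds hq)).differentiableAt (by simp)).hasFDerivAt).comp q.2
      (hasFDerivAt_prodMk_right q.1 q.2)
  have hDc : ContinuousOn D O :=
    (hΨ.continuousOn_fderiv_of_isOpen hO (by simp)).clm_comp continuousOn_const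
  have hD0 : D (0, e x) = ContinuousLinearMap.id ℝ _ := by
    refine (hΨd _ h0).unique ((hasFDerivAt_id (e x)).congr_of_eventuallyEq ?_)
    have : ∀ᶠ y in 𝓝 (e x), ((0 : ℝ), y) ∈ O :=
      (Continuous.prodMk_right (0 : ℝ)).continuousAt.eventually (hO.mem_nhds h0)
    filter_upwards [this] with y hy
    exact (hΨ0 y hy).1
  have hR : IsOpen (O ∩ D ⁻¹' Set.range (ContinuousLinearEquiv.toContinuousLinearMap :
      (EuclideanSpace ℝ (Fin n) ≃L[ℝ] EuclideanSpace ℝ (Fin n)) → _)) :=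
    hDc.isOpen_inter_preimage hO (ContinuousLinearEquiv.isOpen (𝕜 := ℝ))
  have hmem := hR.mem_nhds ⟨h0, ⟨ContinuousLinearEquiv.refl ℝ _, hD0.symm⟩⟩
  obtain ⟨I, hI, U₀, hU₀, hsub⟩ := mem_nhds_prod_iff.1 hmem
  obtain ⟨ε, hε, hεI⟩ := Metric.mem_nhds_iff.1 hI
  obtain ⟨U₁, hU₁, hU₁o, hxU₁⟩ := mem_nhds_iff.1 hU₀
  have hbox : ∀ s ∈ Set.Ico 0 ε, ∀ y ∈ U₁, (s, y) ∈ O ∩ D ⁻¹' Set.range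
      (ContinuousLinearEquiv.toContinuousLinearMap :
      (EuclideanSpace ℝ (Fin n) ≃L[ℝ] EuclideanSpace ℝ (Fin n)) → _) := fun s hs y hy =>
    hsub ⟨hεI (by rw [Real.ball_eq_Ioo]; exact ⟨by linarith [hs.1], by linarith [hs.2]⟩), hU₁ hy⟩
  have hfl : ∀ s ∈ Set.Ico 0 ε, ∀ z ∈ e.source ∩ e ⁻¹' U₁,
      flow v s z = e.symm (Ψ (s, e z)) := fun s hs z hz => by
    rw [← hflow s (e z) (hbox s hs _ hz.2).1 hs.1, e.left_inv hz.1]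
  refine ⟨e.source ∩ e ⁻¹' U₁, e.isOpen_inter_preimage hU₁o, ⟨hsrc, hxU₁⟩, ε, hε, ?_, ?_⟩
  · have h1 : ContinuousOn (fun q : ℝ × M => e.symm (Ψ (q.1, e q.2)))
        (Set.Ico 0 ε ×ˢ (e.source ∩ e ⁻¹' U₁)) := by
      refine e.continuousOn_symm.comp (hΨ.continuousOn.comp (continuousOn_fst.prodMk
        (e.continuousOn.comp continuousOn_snd fun q hq => hq.2.1)) ?_) ?_
      · exact fun q hq => (hbox q.1 hq.1 _ hq.2.2).1
      · exact fun q hq => (htgt _ (hbox q.1 hq.1 _ hq.2.2).1).2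
    exact h1.congr fun q hq => hfl q.1 hq.1 q.2 hq.2
  · intro s hs A hA
    have hA' := (hl.null_iff_of_subset_source he Set.inter_subset_right).1
      (measure_mono_null (Set.inter_subset_left (t := e.source)) hA)
    refine (hl.null_iff_of_subset_source he
      (Set.inter_subset_left.trans Set.inter_subset_left)).2 ?_
    refine measure_mono_null ?_ (addHaar_inter_preimage_eq_zero volume (f := fun y => Ψ (s, y))
      hU₁o ?_ ?_ hA')
    · rintro _ ⟨z, ⟨hzU, hzA⟩, rfl⟩
      have hΨt := (htgt _ (hbox s hs _ hzU.2).1).2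
      refine ⟨hzU.2, e.symm (Ψ (s, e z)), ⟨?_, e.map_target hΨt⟩, e.right_inv hΨt⟩
      rw [← hfl s hs z hzU]
      exact hzA
    · exact (hΨ.of_le (by simp)).comp (contDiff_prodMk_right s).contDiffOn
        fun y hy => (hbox s hs y hy).1
    · intro y hy
      obtain ⟨L, hL⟩ := (hbox s hs y hy).2
      rw [(hΨd _ (hbox s hs y hy).1).fderiv, ← hL]
      exact L.injective

/-- Forward completeness provides no global inverse, so the property is carried along the trajectory
of `x`: the semigroup law composes it with short-time flows, and continuous induction reaches `T`.
-/
theorem exists_nhds_flow_longTime (hl : IsLebesgueMeasure n lambdaM) (hv : IsForwardComplete v)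
    (x : M) {T : ℝ} (hT : 0 ≤ T) : ∃ U : Set M, IsOpen U ∧ x ∈ U ∧ ContinuousOn (flow v T) U ∧
      ∀ A, lambdaM A = 0 → lambdaM (U ∩ flow v T ⁻¹' A) = 0 := by
  set C : ℝ → Prop := fun t => ∃ U : Set M, IsOpen U ∧ x ∈ U ∧ ContinuousOn (flow v t) U ∧
      ∀ A, lambdaM A = 0 → lambdaM (U ∩ flow v t ⁻¹' A) = 0 with hC
  have hstep : ∀ t, 0 ≤ t → ∃ δ > 0, ∀ r τ, 0 ≤ r → |r - t| < δ → |τ - t| < δ → r ≤ τ →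
      C r → C τ := by
    intro t ht
    obtain ⟨U, hU, hxU, ε, hε, hcont, hnull⟩ := exists_nhds_flow_shortTime hl hv (flow v t x)
    have hγ : ContinuousWithinAt (fun τ => flow v τ x) (Set.Ici 0) t :=
      (flow_spec hv x).2.continuousWithinAt ht
    obtain ⟨δ, hδ, hδU⟩ := Metric.mem_nhdsWithin_iff.1 (hγ.preimage_mem_nhdsWithin (hU.mem_nhds hxU))
    refine ⟨min δ (ε / 2), lt_min hδ (half_pos hε), ?_⟩
    rintro r τ hr hrt hτt hrτ ⟨V, hV, hxV, hVc, hVn⟩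
    have hrU : flow v r x ∈ U := hδU ⟨by
      rw [Metric.mem_ball, Real.dist_eq]; exact hrt.trans_le (min_le_left _ _), hr⟩
    have hs : τ - r ∈ Set.Ico 0 ε := by
      have h1 := abs_lt.1 (hrt.trans_le (min_le_right _ _))
      have h2 := abs_lt.1 (hτt.trans_le (min_le_right _ _))
      exact ⟨by linarith, by linarith [h1.1, h2.2]⟩
    have hcomp : ∀ z, flow v τ z = flow v (τ - r) (flow v r z) := fun z => by
      rw [← flow_add hv hs.1 hr, sub_add_cancel]
    refine ⟨V ∩ flow v r ⁻¹' U, hVc.isOpen_inter_preimage hV hU, ⟨hxV, hrU⟩, ?_, ?_⟩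
    · have h1 : ContinuousOn (fun z => flow v (τ - r) (flow v r z)) (V ∩ flow v r ⁻¹' U) :=
        hcont.comp (continuousOn_const.prodMk (hVc.mono Set.inter_subset_left))
          fun z hz => ⟨hs, hz.2⟩
      exact h1.congr fun z _ => hcomp z
    · intro A hA
      refine measure_mono_null ?_ (hVn _ (hnull _ hs A hA))
      rintro z ⟨⟨hzV, hzU⟩, hzA⟩
      refine ⟨hzV, hzU, ?_⟩
      rw [Set.mem_preimage, ← hcomp]
      exact hzA
  have hC0 : C 0 := by
    refine ⟨Set.univ, isOpen_univ, trivial, ?_, fun A hA => ?_⟩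
    · exact continuousOn_id.congr fun z _ => flow_zero hv z
    · refine measure_mono_null ?_ hA
      rintro z ⟨-, hz⟩
      rwa [Set.mem_preimage, flow_zero hv] at hz
  -- Requiring `C` at all earlier times as well makes the set of good times an initial segment, and
  -- this is what allows its closedness to be proved with steps that only go forward.
  have key : Set.Icc 0 T ⊆ {t | ∀ τ ∈ Set.Icc 0 t, C τ} := by
    refine IsClosed.Icc_subset_of_forall_exists_gt ?_ ?_ ?_
    · refine isClosed_of_closure_subset fun t ht => ?_
      have htI : t ∈ Set.Icc 0 T := isClosed_Icc.closure_subset_iff.2 Set.inter_subset_right ht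
      refine ⟨fun τ hτ => ?_, htI⟩
      obtain ⟨δ, hδ, hprop⟩ := hstep t htI.1
      obtain ⟨r, ⟨hrS, hrI⟩, hrt⟩ := Metric.mem_closure_iff.1 ht δ hδ
      rw [Real.dist_eq, abs_sub_comm] at hrt
      rcases le_or_gt τ r with h | h
      · exact hrS τ ⟨hτ.1, h⟩
      · refine hprop r τ hrI.1 hrt ?_ h.le (hrS r ⟨hrI.1, le_rfl⟩)
        rw [abs_lt] at hrt ⊢
        exact ⟨by linarith [hrt.1], by linarith [hτ.2]⟩
    · intro τ hτ
      obtain rfl : τ = 0 := le_antisymm hτ.2 hτ.1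
      exact hC0
    · rintro t ⟨htS, htI⟩ y (hy : t < y)
      obtain ⟨δ, hδ, hprop⟩ := hstep t htI.1
      refine ⟨min y (t + δ / 2), fun τ hτ => ?_, lt_min hy (by linarith), min_le_left _ _⟩
      rcases le_or_gt τ t with h | h
      · exact htS τ ⟨hτ.1, h⟩
      · refine hprop t τ htI.1 (by simpa using hδ) ?_ h.le (htS t ⟨htI.1, le_rfl⟩)
        have := hτ.2.trans (min_le_right _ _)
        rw [abs_lt]
        exact ⟨by linarith, by linarith⟩
  exact key ⟨hT, le_rfl⟩ T ⟨hT, le_rfl⟩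

theorem continuous_flow_apply (hl : IsLebesgueMeasure n lambdaM) (hv : IsForwardComplete v)
    (t : ℝ) : Continuous (flow v t) := by
  rw [continuous_iff_continuousAt]
  intro x
  obtain ⟨U, hU, hxU, hc, -⟩ := exists_nhds_flow_longTime hl hv x (le_max_right t 0)
  have h : flow v (max t 0) = flow v t := funext fun z => flow_max t z
  rw [h] at hc
  exact hc.continuousAt (hU.mem_nhds hxU)

/-- Flow maps pull Lebesgue null sets back to Lebesgue null sets. -/
theorem flow_preimage_null [SecondCountableTopology M] (hl : IsLebesgueMeasure n lambdaM)
    (hv : IsForwardComplete v) (t : ℝ) {A : Set M} (hA : lambdaM A = 0) :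
    lambdaM (flow v t ⁻¹' A) = 0 := by
  refine measure_null_of_locally_null _ fun x _ => ?_
  obtain ⟨U, hU, hxU, -, hn⟩ := exists_nhds_flow_longTime hl hv x (le_max_right t 0)
  have h : flow v (max t 0) = flow v t := funext fun z => flow_max t z
  rw [h] at hn
  exact ⟨U ∩ flow v t ⁻¹' A, Filter.inter_mem (mem_nhdsWithin_of_mem_nhds (hU.mem_nhds hxU))
    self_mem_nhdsWithin, hn A hA⟩

/-- Near `(t, x)` the flow factors as the flow up to a fixed time `r`, continuous in space, followed
by a short-time flow, which is jointly continuous. -/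
theorem continuous_flow (hl : IsLebesgueMeasure n lambdaM) (hv : IsForwardComplete v) :
    Continuous fun q : ℝ × M => flow v q.1 q.2 := by
  suffices h : ContinuousOn (fun q : ℝ × M => flow v q.1 q.2) (Set.Ici 0 ×ˢ Set.univ) by
    have h1 : Continuous fun q : ℝ × M => flow v (max q.1 0) q.2 :=
      h.comp_continuous (f := fun q : ℝ × M => (max q.1 0, q.2)) (by fun_prop)
        fun q => ⟨le_max_right q.1 0, trivial⟩
    simpa only [flow_max] using h1
  rintro ⟨t, x⟩ ⟨ht, -⟩
  replace ht : 0 ≤ t := ht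
  obtain ⟨U, hU, hxU, ε, hε, hcont, -⟩ := exists_nhds_flow_shortTime hl hv (flow v t x)
  have hγ : ContinuousWithinAt (fun τ => flow v τ x) (Set.Ici 0) t :=
    (flow_spec hv x).2.continuousWithinAt ht
  obtain ⟨δ, hδ, hδU⟩ := Metric.mem_nhdsWithin_iff.1 (hγ.preimage_mem_nhdsWithin (hU.mem_nhds hxU))
  -- The time `r` lies strictly before `t` when `t > 0`, so that the remaining time is nonnegative
  -- on both sides of `t`; for `t = 0` it is `0`.
  set r := max 0 (t - min (δ / 2) (ε / 2)) with hr_def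
  have hr : 0 ≤ r := le_max_left _ _
  have hm : 0 < min (δ / 2) (ε / 2) := lt_min (half_pos hδ) (half_pos hε)
  have hrt : r ≤ t := max_le ht (by linarith)
  have hrt2 : t - min (δ / 2) (ε / 2) ≤ r := le_max_right _ _
  have hrU : flow v r x ∈ U := hδU ⟨by
    rw [Metric.mem_ball, Real.dist_eq, abs_lt]
    have := min_le_left (δ / 2) (ε / 2)
    exact ⟨by linarith, by linarith⟩, hr⟩
  have hset : {q : ℝ × M | q.1 - r ∈ Set.Ico 0 ε ∧ flow v r q.2 ∈ U} ∈
      𝓝[Set.Ici 0 ×ˢ Set.univ] (t, x) := by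
    have h1 : ∀ᶠ q in 𝓝 (t, x), q.1 - r < ε := by
      refine (continuous_fst.sub continuous_const).continuousAt.eventually_lt continuousAt_const ?_
      have := min_le_right (δ / 2) (ε / 2)
      change t - r < ε
      linarith
    have h2 : ∀ᶠ q : ℝ × M in 𝓝 (t, x), flow v r q.2 ∈ U :=
      ((continuous_flow_apply hl hv r).comp continuous_snd).continuousAt.eventually
        (hU.mem_nhds hrU)
    have h3 : ∀ᶠ q in 𝓝[Set.Ici 0 ×ˢ Set.univ] (t, x), r ≤ q.1 := by
      rcases ht.eq_or_lt with h | h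
      · have : r = 0 := le_antisymm (hrt.trans h.ge) hr
        filter_upwards [self_mem_nhdsWithin] with q hq
        rw [this]
        exact hq.1
      · have : r < t := max_lt h (by linarith)
        filter_upwards [mem_nhdsWithin_of_mem_nhds
          (continuous_fst.continuousAt.eventually (lt_mem_nhds this))] with q hq
        exact le_of_lt hq
    filter_upwards [mem_nhdsWithin_of_mem_nhds h1, mem_nhdsWithin_of_mem_nhds h2, h3]
      with q h1 h2 h3
    exact ⟨⟨sub_nonneg.2 h3, h1⟩, h2⟩
  have h1 : ContinuousOn (fun q : ℝ × M => flow v (q.1 - r) (flow v r q.2))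
      {q : ℝ × M | q.1 - r ∈ Set.Ico 0 ε ∧ flow v r q.2 ∈ U} :=
    hcont.comp ((continuous_fst.sub continuous_const).prodMk
      ((continuous_flow_apply hl hv r).comp continuous_snd)).continuousOn fun q hq => hq
  have h2 : ContinuousOn (fun q : ℝ × M => flow v q.1 q.2)
      {q : ℝ × M | q.1 - r ∈ Set.Ico 0 ε ∧ flow v r q.2 ∈ U} :=
    h1.congr fun q hq => by
      simp only
      rw [← flow_add hv hq.1.1 hr, sub_add_cancel]
  have hq0 : (t, x) ∈ {q : ℝ × M | q.1 - r ∈ Set.Ico 0 ε ∧ flow v r q.2 ∈ U} :=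
    mem_of_mem_nhdsWithin (s := Set.Ici 0 ×ˢ Set.univ) ⟨ht, trivial⟩ hset
  exact (h2 _ hq0).mono_of_mem_nhdsWithin hset

end GlobalFlow

/-! ### Measurability of the driving noise and its first switches. -/

section Noise

variable {k : ℕ}

/-- The exponential density is positive on the half-line, so almost sure statements about holding
times become statements about Lebesgue almost every time. -/
theorem volume_restrict_Ioi_absolutelyContinuous_expMeasure {r : ℝ} (hr : 0 < r) :
    (volume : Measure ℝ).restrict (Set.Ioi 0) ≪ expMeasure r := by
  have h : (volume : Measure ℝ).restrict (Set.Ioi 0) ≪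
      (volume.restrict (Set.Ioi 0)).withDensity (exponentialPDF r) := by
    refine withDensity_absolutelyContinuous'
      (measurable_exponentialPDFReal r).ennreal_ofReal.aemeasurable ?_
    filter_upwards [ae_restrict_mem measurableSet_Ioi] with x hx
    exact (ENNReal.ofReal_pos.2 (exponentialPDFReal_pos hr hx)).ne'
  refine h.trans ?_
  rw [← restrict_withDensity measurableSet_Ioi]
  exact Measure.absolutelyContinuous_of_le Measure.restrict_le_self

namespace SwitchingSystem

theorem measurable_regimeSeq (i : Fin k) (m : ℕ) : Measurable fun noise => regimeSeq i noise m := by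
  induction m with
  | zero => exact measurable_const
  | succ m ih =>
    have h : Measurable fun q : (ℕ × Fin k → ℝ × Fin k) × Fin k => (q.1 (m, q.2)).2 :=
      measurable_from_prod_countable_left fun j => measurable_snd.comp (measurable_pi_apply (m, j))
    exact h.comp (measurable_id.prodMk ih)

theorem measurable_holdingTime (i : Fin k) (m : ℕ) :
    Measurable fun noise => holdingTime i noise m := by
  have h : Measurable fun q : (ℕ × Fin k → ℝ × Fin k) × Fin k => (q.1 (m, q.2)).1 :=
    measurable_from_prod_countable_left fun j => measurable_fst.comp (measurable_pi_apply (m, j))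
  exact h.comp (measurable_id.prodMk (measurable_regimeSeq i m))

theorem measurable_switchTime (i : Fin k) (m : ℕ) :
    Measurable fun noise => switchTime i noise m :=
  Finset.measurable_sum _ fun l _ => measurable_holdingTime i l

theorem measurable_numSwitches (i : Fin k) :
    Measurable fun q : ℝ × (ℕ × Fin k → ℝ × Fin k) => numSwitches i q.1 q.2 := by
  have hS : ∀ m, MeasurableSet {q : ℝ × (ℕ × Fin k → ℝ × Fin k) | q.1 < switchTime i q.2 (m + 1)} :=
    fun m => measurableSet_lt measurable_fst ((measurable_switchTime i (m + 1)).comp measurable_snd)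
  refine measurable_to_countable' fun m => ?_
  -- The second set of the union accounts for the default value `sInf ∅ = 0`, taken when no switch
  -- time exceeds `q.1`.
  have h : (fun q : ℝ × (ℕ × Fin k → ℝ × Fin k) => numSwitches i q.1 q.2) ⁻¹' {m} =
      ({q | q.1 < switchTime i q.2 (m + 1)} ∩
        ⋂ l ∈ Set.Iio m, {q | q.1 < switchTime i q.2 (l + 1)}ᶜ) ∪
      ({q | m = 0} ∩ ⋂ l, {q | q.1 < switchTime i q.2 (l + 1)}ᶜ) := by
    ext q
    simp only [Set.mem_preimage, Set.mem_singleton_iff, Set.mem_union, Set.mem_inter_iff,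
      Set.mem_iInter, Set.mem_compl_iff, Set.mem_ofPred_eq, Set.mem_Iio]
    constructor
    · intro hq
      rcases Set.eq_empty_or_nonempty {m | q.1 < switchTime i q.2 (m + 1)} with he | hne
      · right
        refine ⟨?_, fun l hl => ?_⟩
        · rw [← hq, numSwitches, he, Nat.sInf_empty]
        · exact (Set.mem_empty_iff_false l).1 (he ▸ hl)
      · left
        subst hq
        exact ⟨Nat.sInf_mem hne, fun l hl => Nat.notMem_of_lt_sInf hl⟩
    · rintro (⟨h1, h2⟩ | ⟨rfl, h2⟩)
      · refine le_antisymm (Nat.sInf_le h1) (le_of_not_gt fun hlt => ?_)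
        have hne : {m | q.1 < switchTime i q.2 (m + 1)}.Nonempty := ⟨m, h1⟩
        exact h2 _ hlt (Nat.sInf_mem hne)
      · have he : {m | q.1 < switchTime i q.2 (m + 1)} = ∅ := Set.eq_empty_of_forall_notMem h2
        rw [numSwitches, he, Nat.sInf_empty]
  rw [h]
  refine ((hS m).inter (MeasurableSet.biInter (Set.to_countable _) fun l _ => (hS l).compl)).union
    ((MeasurableSet.const _).inter (MeasurableSet.iInter fun l => (hS l).compl))

theorem numSwitches_eq_zero {i : Fin k} {t : ℝ} {noise : ℕ × Fin k → ℝ × Fin k}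
    (ht : t < (noise (0, i)).1) : numSwitches i t noise = 0 :=
  Nat.le_zero.1 (Nat.sInf_le (by simpa [switchTime, holdingTime, regimeSeq] using ht))

theorem numSwitches_eq_one {i j : Fin k} {t : ℝ} {noise : ℕ × Fin k → ℝ × Fin k}
    (h1 : (noise (0, i)).1 ≤ t) (h2 : t < (noise (0, i)).1 + (noise (1, j)).1)
    (hj : (noise (0, i)).2 = j) : numSwitches i t noise = 1 := by
  have hmem : 1 ∈ {m | t < switchTime i noise (m + 1)} := by
    simpa [switchTime, holdingTime, regimeSeq, Finset.sum_range_succ, hj] using h2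
  refine le_antisymm (Nat.sInf_le hmem) (Nat.one_le_iff_ne_zero.2 fun h0 => ?_)
  have h3 := Nat.sInf_mem ⟨1, hmem⟩
  rw [show sInf {m | t < switchTime i noise (m + 1)} = 0 from h0] at h3
  simp [switchTime, holdingTime, regimeSeq] at h3
  exact absurd h1 (not_le.2 h3)

end SwitchingSystem

end Noise

/-! ### The state of the process and absorbing sets. -/

namespace SwitchingSystem

variable {n k : ℕ} {M : Type*} [TopologicalSpace M]
  [ChartedSpace (EuclideanSpace ℝ (Fin n)) M] [IsManifold (𝓡 n) ∞ M]
  (sys : SwitchingSystem n k M)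

instance isProbabilityMeasure_noise (q : ℕ × Fin k) :
    IsProbabilityMeasure ((expMeasure (sys.rate q.2)).prod (sys.next q.2).toMeasure) := by
  have := isProbabilityMeasure_expMeasure (sys.rate_pos q.2)
  infer_instance

instance : IsProbabilityMeasure sys.noiseLaw := by
  unfold noiseLaw
  infer_instance

/-- The state of the process as a function of starting point, time and noise. -/
def stateAt (x : M × Fin k) (t : ℝ) (noise : ℕ × Fin k → ℝ × Fin k) : M × Fin k :=
  (sys.positionAt x.1 x.2 t noise, regimeAt x.2 t noise)

theorem stateAt_of_lt {ξ : M} {i : Fin k} {t : ℝ} {noise : ℕ × Fin k → ℝ × Fin k}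
    (ht : t < (noise (0, i)).1) : sys.stateAt (ξ, i) t noise = (flow (sys.field i) t ξ, i) := by
  simp only [stateAt, positionAt, regimeAt, numSwitches_eq_zero ht]
  simp [regimeSeq, switchTime, positionSeq]

theorem stateAt_of_one_switch {ξ : M} {i j : Fin k} {t : ℝ} {noise : ℕ × Fin k → ℝ × Fin k}
    (h1 : (noise (0, i)).1 ≤ t) (h2 : t < (noise (0, i)).1 + (noise (1, j)).1)
    (hj : (noise (0, i)).2 = j) : sys.stateAt (ξ, i) t noise =
      (flow (sys.field j) (t - (noise (0, i)).1) (flow (sys.field i) (noise (0, i)).1 ξ), j) := by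
  simp only [stateAt, positionAt, regimeAt, numSwitches_eq_one h1 h2 hj]
  simp [regimeSeq, switchTime, positionSeq, holdingTime, hj]

theorem measurable_positionSeq [MeasurableSpace M]
    (hf : ∀ i, Measurable fun q : ℝ × M => flow (sys.field i) q.1 q.2) (i : Fin k) (m : ℕ) :
    Measurable fun q : M × (ℕ × Fin k → ℝ × Fin k) => sys.positionSeq q.1 i q.2 m := by
  induction m with
  | zero => exact measurable_fst
  | succ m ih =>
    have h : Measurable fun q : (ℝ × M) × Fin k => flow (sys.field q.2) q.1.1 q.1.2 :=
      measurable_from_prod_countable_left hf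
    exact h.comp ((((measurable_holdingTime i m).comp measurable_snd).prodMk ih).prodMk
      ((measurable_regimeSeq i m).comp measurable_snd))

theorem measurable_stateAt [MeasurableSpace M]
    (hf : ∀ i, Measurable fun q : ℝ × M => flow (sys.field i) q.1 q.2) :
    Measurable fun q : (ℝ × (M × Fin k)) × (ℕ × Fin k → ℝ × Fin k) =>
      sys.stateAt q.1.2 q.1.1 q.2 := by
  have hflow : Measurable fun q : (ℝ × M) × Fin k => flow (sys.field q.2) q.1.1 q.1.2 :=
    measurable_from_prod_countable_left hf
  have h1 : ∀ i m, Measurable fun q : (ℝ × M) × (ℕ × Fin k → ℝ × Fin k) =>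
      (flow (sys.field (regimeSeq i q.2 m)) (q.1.1 - switchTime i q.2 m)
        (sys.positionSeq q.1.2 i q.2 m), regimeSeq i q.2 m) := by
    intro i m
    have hr : Measurable fun q : (ℝ × M) × (ℕ × Fin k → ℝ × Fin k) => regimeSeq i q.2 m :=
      (measurable_regimeSeq i m).comp measurable_snd
    refine Measurable.prodMk (hflow.comp ((Measurable.prodMk ?_ ?_).prodMk hr)) hr
    · exact measurable_fst.fst.sub ((measurable_switchTime i m).comp measurable_snd)
    · exact (sys.measurable_positionSeq hf i m).comp (measurable_fst.snd.prodMk measurable_snd)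
  have h2 : ∀ i, Measurable fun q : ((ℝ × M) × (ℕ × Fin k → ℝ × Fin k)) × ℕ =>
      (flow (sys.field (regimeSeq i q.1.2 q.2)) (q.1.1.1 - switchTime i q.1.2 q.2)
        (sys.positionSeq q.1.1.2 i q.1.2 q.2), regimeSeq i q.1.2 q.2) :=
    fun i => measurable_from_prod_countable_left (h1 i)
  have h3 : ∀ i, Measurable fun q : (ℝ × M) × (ℕ × Fin k → ℝ × Fin k) =>
      sys.stateAt (q.1.2, i) q.1.1 q.2 := fun i =>
    (h2 i).comp (measurable_id.prodMk
      ((measurable_numSwitches i).comp (measurable_fst.fst.prodMk measurable_snd)))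
  have h4 : Measurable fun q : ((ℝ × M) × (ℕ × Fin k → ℝ × Fin k)) × Fin k =>
      sys.stateAt (q.1.1.2, q.2) q.1.1.1 q.1.2 := measurable_from_prod_countable_left h3
  exact h4.comp (((measurable_fst.fst.prodMk measurable_fst.snd.fst).prodMk measurable_snd).prodMk
    measurable_fst.snd.snd)

/-- With positive probability no switch occurs up to time `t`, and then the state is given by the
flow of `u_i`; a deterministic outcome of positive probability must lie in `N`. -/
theorem ae_flow_mem_of_ae_stateAt_mem {N : Set (M × Fin k)} {ξ : M} {i : Fin k}
    (h : ∀ᵐ t ∂(volume.restrict (Set.Ioi (0 : ℝ))), ∀ᵐ noise ∂sys.noiseLaw,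
      sys.stateAt (ξ, i) t noise ∈ N) :
    ∀ᵐ t ∂(volume.restrict (Set.Ioi (0 : ℝ))), (flow (sys.field i) t ξ, i) ∈ N := by
  filter_upwards [h, ae_restrict_mem measurableSet_Ioi] with t ht ht0
  by_contra hcon
  have h1 : ∀ᵐ noise ∂sys.noiseLaw, ¬ t < (noise (0, i)).1 := by
    filter_upwards [ht] with noise hnoise hlt
    rw [sys.stateAt_of_lt hlt] at hnoise
    exact hcon hnoise
  have := isProbabilityMeasure_expMeasure (sys.rate_pos i)
  have h2 : sys.noiseLaw ((fun noise => noise (0, i)) ⁻¹' (Set.Ioi t ×ˢ Set.univ)) = 0 := by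
    rw [ae_iff] at h1
    simpa [Set.preimage] using h1
  rw [noiseLaw, (measurePreserving_eval_infinitePi _ (0, i)).measure_preimage
    (measurableSet_Ioi.prod .univ).nullMeasurableSet, Measure.prod_prod, measure_univ, mul_one] at h2
  have h3 := volume_restrict_Ioi_absolutelyContinuous_expMeasure (sys.rate_pos i) h2
  rw [Measure.restrict_apply measurableSet_Ioi, Set.Ioi_inter_Ioi, max_eq_left (le_of_lt ht0)] at h3
  simp at h3

variable [MeasurableSpace M]

theorem transition_apply (hf : ∀ i, Measurable fun q : ℝ × M => flow (sys.field i) q.1 q.2)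
    (t : ℝ) (x : M × Fin k) {B : Set (M × Fin k)} (hB : MeasurableSet B) :
    sys.transition t x B = sys.noiseLaw {noise | sys.stateAt x t noise ∈ B} := by
  have h : Measurable (sys.stateAt x t) := (sys.measurable_stateAt hf).comp
    (measurable_prodMk_left (x := (t, x)))
  exact Measure.map_apply h hB

/-- For each fixed `t`, invariance gives the claim for `μ`-almost every `x`, with an exceptional set
depending on `t`; Fubini exchanges the two quantifiers. -/
theorem ae_ae_ae_stateAt_mem (hf : ∀ i, Measurable fun q : ℝ × M => flow (sys.field i) q.1 q.2)
    {μ : Measure (M × Fin k)} [IsProbabilityMeasure μ] (hμ : sys.IsInvariant μ)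
    {N : Set (M × Fin k)} (hN : MeasurableSet N) (hN0 : μ Nᶜ = 0) :
    ∀ᵐ x ∂μ, ∀ᵐ t ∂(volume.restrict (Set.Ioi (0 : ℝ))), ∀ᵐ noise ∂sys.noiseLaw,
      sys.stateAt x t noise ∈ N := by
  have hset : MeasurableSet {q : (ℝ × (M × Fin k)) × (ℕ × Fin k → ℝ × Fin k) |
      sys.stateAt q.1.2 q.1.1 q.2 ∈ Nᶜ} := sys.measurable_stateAt hf hN.compl
  have hmeas : Measurable fun q : ℝ × (M × Fin k) =>
      sys.noiseLaw {noise | sys.stateAt q.2 q.1 noise ∈ Nᶜ} := measurable_measure_prodMk_left hset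
  have h1 : ∀ᵐ t ∂(volume.restrict (Set.Ioi (0 : ℝ))), ∀ᵐ x ∂μ,
      sys.noiseLaw {noise | sys.stateAt x t noise ∈ Nᶜ} = 0 := by
    filter_upwards [ae_restrict_mem measurableSet_Ioi] with t ht
    have h2 := hμ t (le_of_lt ht) Nᶜ hN.compl
    simp only [sys.transition_apply hf t _ hN.compl] at h2
    exact (lintegral_eq_zero_iff (hmeas.comp (measurable_prodMk_left (x := t)))).1 (h2.trans hN0)
  exact (Measure.ae_ae_comm (p := fun t x => sys.noiseLaw {noise | sys.stateAt x t noise ∈ Nᶜ} = 0)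
    (measurableSet_eq_fun hmeas measurable_const)).1 h1

/-- Consider the event of exactly one switch up to time `t`, into regime `j` at time `s`. Given `s`,
it has positive probability and determines the state; the change of variable `r = t - s` then gives
the claim. -/
theorem ae_flow_flow_mem_of_ae_stateAt_mem
    (hf : ∀ i, Measurable fun q : ℝ × M => flow (sys.field i) q.1 q.2)
    {N : Set (M × Fin k)} (hN : MeasurableSet N) {ξ : M} {i j : Fin k} (hij : i ≠ j)
    (h : ∀ᵐ t ∂(volume.restrict (Set.Ioi (0 : ℝ))), ∀ᵐ noise ∂sys.noiseLaw,
      sys.stateAt (ξ, i) t noise ∈ N) :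
    ∀ᵐ s ∂(volume.restrict (Set.Ioi (0 : ℝ))), ∀ᵐ r ∂(volume.restrict (Set.Ioi (0 : ℝ))),
      (flow (sys.field j) r (flow (sys.field i) s ξ), j) ∈ N := by
  have hflow : Measurable fun q : ℝ × ℝ =>
      (flow (sys.field j) (q.1 - q.2) (flow (sys.field i) q.2 ξ), j) :=
    ((hf j).comp ((measurable_fst.sub measurable_snd).prodMk
      ((hf i).comp (measurable_snd.prodMk measurable_const)))).prodMk measurable_const
  have h1 : ∀ᵐ t ∂(volume.restrict (Set.Ioi (0 : ℝ))), ∀ᵐ s ∂(volume.restrict (Set.Ioi (0 : ℝ))),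
      s ≤ t → (flow (sys.field j) (t - s) (flow (sys.field i) s ξ), j) ∈ N := by
    filter_upwards [h] with t ht
    have hpi := isProbabilityMeasure_expMeasure (sys.rate_pos i)
    have hpj := isProbabilityMeasure_expMeasure (sys.rate_pos j)
    have hne : ((0, i) : ℕ × Fin k) ≠ (1, j) := by simp
    have h2 : ∀ᵐ p ∂(((expMeasure (sys.rate i)).prod (sys.next i).toMeasure).prod
        ((expMeasure (sys.rate j)).prod (sys.next j).toMeasure)),
        p.1.2 = j → p.1.1 ≤ t → t < p.1.1 + p.2.1 →
          (flow (sys.field j) (t - p.1.1) (flow (sys.field i) p.1.1 ξ), j) ∈ N := by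
      have hmap := Measure.infinitePi_map_eval_prod (P := fun q : ℕ × Fin k =>
        (expMeasure (sys.rate q.2)).prod (sys.next q.2).toMeasure) hne
      rw [← hmap]
      refine (ae_map_iff (by fun_prop) ?_).2 ?_
      · have m1 : MeasurableSet {p : (ℝ × Fin k) × (ℝ × Fin k) | p.1.2 = j} :=
          measurable_fst.snd (measurableSet_singleton j)
        have m2 : MeasurableSet {p : (ℝ × Fin k) × (ℝ × Fin k) | p.1.1 ≤ t} :=
          measurableSet_le measurable_fst.fst measurable_const
        have m3 : MeasurableSet {p : (ℝ × Fin k) × (ℝ × Fin k) | t < p.1.1 + p.2.1} :=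
          measurableSet_lt measurable_const (measurable_fst.fst.add measurable_snd.fst)
        have m4 : MeasurableSet {p : (ℝ × Fin k) × (ℝ × Fin k) |
            (flow (sys.field j) (t - p.1.1) (flow (sys.field i) p.1.1 ξ), j) ∈ N} :=
          (hflow.comp (measurable_const.prodMk measurable_fst.fst)) hN
        exact m1.imp (m2.imp (m3.imp m4))
      · filter_upwards [ht] with noise hnoise ha hb hc
        rw [sys.stateAt_of_one_switch hb hc ha] at hnoise
        exact hnoise
    have h3 := Measure.ae_ae_of_ae_prod (Measure.ae_ae_of_ae_prod h2)
    have h4 := (volume_restrict_Ioi_absolutelyContinuous_expMeasure (sys.rate_pos i)).ae_le h3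
    filter_upwards [h4] with s hs hst
    have h5 : ∀ᵐ p ∂((expMeasure (sys.rate j)).prod (sys.next j).toMeasure), t < s + p.1 →
          (flow (sys.field j) (t - s) (flow (sys.field i) s ξ), j) ∈ N := by
      -- The statement for almost every new regime includes `j`, since `j` is an atom.
      have hpos : (sys.next i).toMeasure {j} ≠ 0 := by
        rw [PMF.toMeasure_apply_singleton _ _ (measurableSet_singleton j)]
        exact (sys.next_pos i j hij).ne'
      obtain ⟨a, ha, haj⟩ := ((frequently_ae_iff (p := fun a => a ∈ ({j} : Set (Fin k)))).2
        hpos).and_eventually hs |>.exists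
      obtain rfl : a = j := ha
      filter_upwards [haj] with p hp hlt using hp rfl hst hlt
    -- The second holding time exceeds `t - s` with positive probability, and the conclusion does
    -- not depend on its value.
    have hpos : (expMeasure (sys.rate j)).prod (sys.next j).toMeasure
        (Set.Ioi (t - s) ×ˢ Set.univ) ≠ 0 := by
      rw [Measure.prod_prod, measure_univ, mul_one]
      intro h0
      have h3 := volume_restrict_Ioi_absolutelyContinuous_expMeasure (sys.rate_pos j) h0
      rw [Measure.restrict_apply measurableSet_Ioi, Set.Ioi_inter_Ioi,
        max_eq_left (sub_nonneg.2 hst)] at h3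
      simp at h3
    obtain ⟨p, hp, hpN⟩ := ((frequently_ae_iff
      (p := fun p => p ∈ Set.Ioi (t - s) ×ˢ (Set.univ : Set (Fin k)))).2
        hpos).and_eventually h5 |>.exists
    exact hpN (by linarith [Set.mem_Ioi.1 hp.1])
  have h2 := (Measure.ae_ae_comm (p := fun t s => s ≤ t →
    (flow (sys.field j) (t - s) (flow (sys.field i) s ξ), j) ∈ N)
    ((measurableSet_le measurable_snd measurable_fst).imp (hflow hN))).1 h1
  filter_upwards [h2, ae_restrict_mem measurableSet_Ioi] with s hs hs0
  rw [ae_restrict_iff' measurableSet_Ioi] at hs ⊢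
  -- Lebesgue measure is translation invariant, so almost every `t` may be written as `r + s`.
  have h3 := (measurePreserving_add_right (volume : Measure ℝ) s).quasiMeasurePreserving.ae hs
  filter_upwards [h3] with r hr hr0
  have hr0' : 0 < r := hr0
  have hs0' : 0 < s := hs0
  have := hr (by simp only [Set.mem_Ioi]; linarith) (by linarith)
  rwa [add_sub_cancel_right] at this

/-- A switch from `i` to itself never occurs, so for `i = j` the two segments form a single one
without a switch, of length `r + s`. -/
theorem ae_ae_flow_flow_mem [T2Space M]
    (hf : ∀ i, Measurable fun q : ℝ × M => flow (sys.field i) q.1 q.2)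
    {N : Set (M × Fin k)} (hN : MeasurableSet N) {ξ : M} {i j : Fin k}
    (h : ∀ᵐ t ∂(volume.restrict (Set.Ioi (0 : ℝ))), ∀ᵐ noise ∂sys.noiseLaw,
      sys.stateAt (ξ, i) t noise ∈ N) :
    ∀ᵐ s ∂(volume.restrict (Set.Ioi (0 : ℝ))), ∀ᵐ r ∂(volume.restrict (Set.Ioi (0 : ℝ))),
      (flow (sys.field j) r (flow (sys.field i) s ξ), j) ∈ N := by
  rcases eq_or_ne i j with rfl | hij
  · filter_upwards [ae_restrict_mem measurableSet_Ioi] with s hs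
    have hs' : 0 < s := hs
    have h1 := sys.ae_flow_mem_of_ae_stateAt_mem h
    rw [ae_restrict_iff' measurableSet_Ioi] at h1 ⊢
    filter_upwards [(measurePreserving_add_right (volume : Measure ℝ) s).quasiMeasurePreserving.ae h1]
      with r hr hr0
    have hr0' : 0 < r := hr0
    rw [← flow_add (sys.forwardComplete i) hr0'.le hs'.le]
    exact hr (by simp only [Set.mem_Ioi]; linarith)
  · exact sys.ae_flow_flow_mem_of_ae_stateAt_mem hf hN hij h

/-- A set of full invariant measure contains a measurable one that is almost surely not left along
two successive segments of the process. -/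
theorem exists_absorbing_subset [T2Space M]
    (hf : ∀ i, Measurable fun q : ℝ × M => flow (sys.field i) q.1 q.2)
    {μ : Measure (M × Fin k)} [IsProbabilityMeasure μ] (hμ : sys.IsInvariant μ)
    {N : Set (M × Fin k)} (hN : MeasurableSet N) (hN0 : μ Nᶜ = 0) :
    ∃ G ⊆ N, MeasurableSet G ∧ μ Gᶜ = 0 ∧ ∀ ξ i, (ξ, i) ∈ G → ∀ j,
      ∀ᵐ s ∂(volume.restrict (Set.Ioi (0 : ℝ))), ∀ᵐ r ∂(volume.restrict (Set.Ioi (0 : ℝ))),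
        (flow (sys.field j) r (flow (sys.field i) s ξ), j) ∈ G := by
  have hstep : ∀ A : {A : Set (M × Fin k) // MeasurableSet A ∧ μ Aᶜ = 0},
      ∃ A' : {A : Set (M × Fin k) // MeasurableSet A ∧ μ Aᶜ = 0}, A'.1 ⊆ A.1 ∧
      ∀ ξ i, (ξ, i) ∈ A'.1 → ∀ j,
      ∀ᵐ s ∂(volume.restrict (Set.Ioi (0 : ℝ))), ∀ᵐ r ∂(volume.restrict (Set.Ioi (0 : ℝ))),
        (flow (sys.field j) r (flow (sys.field i) s ξ), j) ∈ A.1 := by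
    rintro ⟨A, hA, hA0⟩
    have h1 := sys.ae_ae_ae_stateAt_mem hf hμ hA hA0
    rw [ae_iff] at h1
    set Z := toMeasurable μ {x | ¬ ∀ᵐ t ∂(volume.restrict (Set.Ioi (0 : ℝ))),
      ∀ᵐ noise ∂sys.noiseLaw, sys.stateAt x t noise ∈ A}
    refine ⟨⟨A ∩ Zᶜ, hA.inter (measurableSet_toMeasurable _ _).compl, ?_⟩,
      Set.inter_subset_left, fun ξ i hx j => ?_⟩
    · rw [Set.compl_inter, compl_compl]
      exact measure_union_null hA0 ((measure_toMeasurable _).trans h1)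
    · refine sys.ae_ae_flow_flow_mem hf hA ?_
      by_contra hcon
      exact hx.2 (subset_toMeasurable _ _ hcon)
  choose next hsub hnext using hstep
  let A : ℕ → {A : Set (M × Fin k) // MeasurableSet A ∧ μ Aᶜ = 0} :=
    fun q => Nat.rec ⟨N, hN, hN0⟩ (fun _ B => next B) q
  -- Each set of the sequence leads almost surely into the preceding one. The intersection therefore
  -- leads into all of them, hence into itself.
  refine ⟨⋂ q, (A q).1, Set.iInter_subset _ 0, MeasurableSet.iInter fun q => (A q).2.1, ?_, ?_⟩
  · rw [Set.compl_iInter]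
    exact measure_iUnion_null fun q => (A q).2.2
  · intro ξ i hx j
    have h1 : ∀ q, ∀ᵐ s ∂(volume.restrict (Set.Ioi (0 : ℝ))),
        ∀ᵐ r ∂(volume.restrict (Set.Ioi (0 : ℝ))),
        (flow (sys.field j) r (flow (sys.field i) s ξ), j) ∈ (A q).1 := fun q =>
      hnext (A q) ξ i (Set.mem_iInter.1 hx (q + 1)) j
    filter_upwards [ae_all_iff.2 h1] with s hs
    filter_upwards [ae_all_iff.2 hs] with r hr
    exact Set.mem_iInter.2 hr

end SwitchingSystem

/-! ### Null sets of the product measure and the law of pure types. -/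

theorem prod_count_null_iff {X ι : Type*} [MeasurableSpace X] [Fintype ι] [MeasurableSpace ι]
    [MeasurableSingletonClass ι] (ν : Measure X) {N : Set (X × ι)} (hN : MeasurableSet N) :
    ν.prod (Measure.count : Measure ι) N = 0 ↔ ∀ j, ν {ξ | (ξ, j) ∈ N} = 0 := by
  rw [Measure.measure_prod_null hN]
  have h1 : (∀ j, ν {ξ | (ξ, j) ∈ N} = 0) ↔ ∀ᵐ ξ ∂ν, ∀ j, (ξ, j) ∉ N := by
    rw [ae_all_iff]
    simp [ae_iff]
  rw [h1]
  refine Filter.eventually_congr (Filter.Eventually.of_forall fun ξ => ?_)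
  rw [Pi.zero_apply, Measure.count_eq_zero_iff, Set.eq_empty_iff_forall_notMem]
  rfl

namespace SwitchingSystem

variable {n k : ℕ} {M : Type*} [TopologicalSpace M] [T2Space M] [SecondCountableTopology M]
  [ChartedSpace (EuclideanSpace ℝ (Fin n)) M] [IsManifold (𝓡 n) ∞ M]
  [MeasurableSpace M] [BorelSpace M] {lambdaM : Measure M}
  (sys : SwitchingSystem n k M)

theorem measurable_flow (hl : IsLebesgueMeasure n lambdaM) (i : Fin k) :
    Measurable fun q : ℝ × M => flow (sys.field i) q.1 q.2 :=
  (continuous_flow hl (sys.forwardComplete i)).measurable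

theorem positionSeq_preimage_null (hl : IsLebesgueMeasure n lambdaM) (i : Fin k)
    (noise : ℕ × Fin k → ℝ × Fin k) (m : ℕ) :
    ∀ {A : Set M}, lambdaM A = 0 → lambdaM {ξ | sys.positionSeq ξ i noise m ∈ A} = 0 := by
  induction m with
  | zero => exact fun hA => hA
  | succ m ih => exact fun hA => ih (flow_preimage_null hl (sys.forwardComplete _) _ hA)

/-- For fixed noise the regimes and switch times do not depend on `ξ`, so the position is a
composition of flow maps applied to `ξ`. -/
theorem stateAt_preimage_null (hl : IsLebesgueMeasure n lambdaM) {N : Set (M × Fin k)}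
    (hN : ∀ j, lambdaM {ξ | (ξ, j) ∈ N} = 0) (i : Fin k) (t : ℝ)
    (noise : ℕ × Fin k → ℝ × Fin k) :
    lambdaM {ξ | sys.stateAt (ξ, i) t noise ∈ N} = 0 :=
  sys.positionSeq_preimage_null hl i noise (numSwitches i t noise)
    (flow_preimage_null hl (sys.forwardComplete (regimeAt i t noise))
      (t - switchTime i noise (numSwitches i t noise)) (hN (regimeAt i t noise)))

/-- The law of pure types for ergodic invariant measures. -/
theorem IsErgodic.absolutelyContinuous_or_singular {sys : SwitchingSystem n k M}
    (hl : IsLebesgueMeasure n lambdaM) {μ : Measure (M × Fin k)} (hμ : sys.IsErgodic μ) :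
    μ ≪ lambdaM.prod (Measure.count : Measure (Fin k)) ∨
      ∃ N : Set (M × Fin k), MeasurableSet N ∧ (∀ j, lambdaM {ξ | (ξ, j) ∈ N} = 0) ∧
        μ Nᶜ = 0 := by
  have := hμ.isProbabilityMeasure
  have hf := fun i => sys.measurable_flow hl i
  obtain ⟨ν, hν, hnull⟩ := hl.exists_sFinite
  -- A finite measure with the null sets of the product measure, to which the Lebesgue decomposition
  -- theorem applies.
  obtain ⟨Λ, hΛf, hΛ1, hΛ2⟩ := exists_isFiniteMeasure_absolutelyContinuous
    (ν.prod (Measure.count : Measure (Fin k)))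
  have hslice : ∀ {A : Set (M × Fin k)}, MeasurableSet A → ∀ j, MeasurableSet {ξ | (ξ, j) ∈ A} :=
    fun hA j => measurable_prodMk_right hA
  have hΛnull : ∀ {A : Set (M × Fin k)}, MeasurableSet A →
      (Λ A = 0 ↔ ∀ j, lambdaM {ξ | (ξ, j) ∈ A} = 0) := fun {A} hA => by
    have h1 : Λ A = 0 ↔ ν.prod (Measure.count : Measure (Fin k)) A = 0 :=
      ⟨fun h => hΛ1 h, fun h => hΛ2 h⟩
    rw [h1, prod_count_null_iff ν hA]
    exact forall_congr' fun j => hnull _ (hslice hA j)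
  -- `Z` carries the absolutely continuous part: the singular part of `μ` vanishes on `Z`, and `Λ`
  -- vanishes off `Z`.
  obtain ⟨Z, hZ, hsing, hΛZ⟩ := Measure.mutuallySingular_singularPart μ Λ
  have hΛN : ∀ j, lambdaM {ξ | (ξ, j) ∈ Zᶜ} = 0 := (hΛnull hZ.compl).1 hΛZ
  have hac : ∀ A ⊆ Z, Λ A = 0 → μ A = 0 := fun A hA hA0 => by
    rw [Measure.haveLebesgueDecomposition_add μ Λ, Measure.add_apply,
      withDensity_absolutelyContinuous _ _ hA0, add_zero]
    exact measure_mono_null hA hsing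
  have hstate : MeasurableSet {q : (ℝ × (M × Fin k)) × (ℕ × Fin k → ℝ × Fin k) |
      sys.stateAt q.1.2 q.1.1 q.2 ∈ Zᶜ} := sys.measurable_stateAt hf hZ.compl
  -- The complement of `Z` is `Λ`-null, so by nonsingularity of the flows and Fubini it is charged
  -- from a `Λ`-null set of starting points only; inside `Z` such a set is `μ`-null.
  have hinv : sys.IsInvariantSet μ Z := by
    intro t ht
    have hst : MeasurableSet {q : (M × Fin k) × (ℕ × Fin k → ℝ × Fin k) |
        sys.stateAt q.1 t q.2 ∈ Zᶜ} :=
      (((measurable_const (a := t)).prodMk measurable_fst).prodMk measurable_snd) hstate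
    have hm : Measurable fun x => sys.noiseLaw {noise | sys.stateAt x t noise ∈ Zᶜ} :=
      measurable_measure_prodMk_left hst
    have hbad : MeasurableSet {x | sys.noiseLaw {noise | sys.stateAt x t noise ∈ Zᶜ} ≠ 0} :=
      (measurableSet_eq_fun hm measurable_const).compl
    have hΛbad : Λ {x | sys.noiseLaw {noise | sys.stateAt x t noise ∈ Zᶜ} ≠ 0} = 0 := by
      refine (hΛnull hbad).2 fun j => ?_
      rw [← hnull _ (hslice hbad j)]
      have hst' : MeasurableSet {q : M × (ℕ × Fin k → ℝ × Fin k) |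
          sys.stateAt (q.1, j) t q.2 ∈ Zᶜ} :=
        ((measurable_fst.prodMk measurable_const).prodMk measurable_snd) hst
      have h1 : ∀ᵐ ξ ∂ν, ∀ᵐ noise ∂sys.noiseLaw, ¬ sys.stateAt (ξ, j) t noise ∈ Zᶜ := by
        refine (Measure.ae_ae_comm (p := fun ξ noise => ¬ sys.stateAt (ξ, j) t noise ∈ Zᶜ)
          hst'.compl).2 (Filter.Eventually.of_forall fun noise => ?_)
        rw [ae_iff]
        simp only [not_not]
        refine (hnull _ (measurable_prodMk_right (y := noise) hst')).2 ?_
        exact sys.stateAt_preimage_null hl hΛN j t noise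
      simpa [ae_iff] using h1
    have hμbad := hac (Z ∩ {x | sys.noiseLaw {noise | sys.stateAt x t noise ∈ Zᶜ} ≠ 0})
      Set.inter_subset_left (measure_mono_null Set.inter_subset_right hΛbad)
    rw [ae_iff]
    refine measure_mono_null ?_ hμbad
    intro x hx
    obtain ⟨hxZ, hx1⟩ := Classical.not_imp.1 hx
    refine ⟨hxZ, fun h0 => hx1 ?_⟩
    rw [sys.transition_apply hf t x hZ]
    refine (prob_compl_eq_zero_iff ?_).1 h0
    exact measurable_prodMk_left (x := (t, x)) (sys.measurable_stateAt hf hZ)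
  rcases hμ.trivial_of_isInvariantSet Z hZ hinv with h | h
  · left
    have hZc : μ Zᶜ = 0 := (prob_compl_eq_zero_iff hZ).2 h
    refine Measure.AbsolutelyContinuous.mk fun A hA hA0 => ?_
    have hΛA : Λ A = 0 := (hΛnull hA).2 ((prod_count_null_iff lambdaM hA).1 hA0)
    rw [← Set.inter_union_compl A Z]
    exact measure_union_null (hac _ Set.inter_subset_right
      (measure_mono_null Set.inter_subset_left hΛA))
      (measure_mono_null Set.inter_subset_right hZc)
  · right
    exact ⟨Zᶜ, hZ.compl, hΛN, by rwa [compl_compl]⟩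

end SwitchingSystem

/-! ### Related vector fields and lifts along immersions. -/

section Related

variable {P E : Type*} [NormedAddCommGroup P] [NormedSpace ℝ P]
  [NormedAddCommGroup E] [NormedSpace ℝ E]

/-- Differentiate the relation `DF · w = X ∘ F` in the direction `z`. In the bracket of two related
pairs the second derivatives of `F` cancel by symmetry. -/
theorem fderiv_fderiv_apply_eq_of_related {F : P → E} {X : E → E} {w : P → P} {V : Set P}
    (hV : IsOpen V) {p : P} (hp : p ∈ V) (hF : ContDiffAt ℝ 2 F p)
    (hX : DifferentiableAt ℝ X (F p)) (hw : DifferentiableAt ℝ w p)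
    (h : ∀ q ∈ V, fderiv ℝ F q (w q) = X (F q)) (z : P) :
    fderiv ℝ (fderiv ℝ F) p z (w p) + fderiv ℝ F p (fderiv ℝ w p z)
      = fderiv ℝ X (F p) (fderiv ℝ F p z) := by
  have hF' : DifferentiableAt ℝ (fderiv ℝ F) p :=
    (hF.fderiv_right (m := 1) (by norm_num)).differentiableAt (by norm_num)
  have h1 := hF'.hasFDerivAt.clm_apply hw.hasFDerivAt
  have h2 := hX.hasFDerivAt.comp p (hF.differentiableAt (by norm_num)).hasFDerivAt
  have h3 : (fun q => fderiv ℝ F q (w q)) =ᶠ[𝓝 p] X ∘ F := by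
    filter_upwards [hV.mem_nhds hp] with q hq using h q hq
  have h4 := DFunLike.congr_fun (h1.unique (h2.congr_of_eventuallyEq h3)) z
  simp at h4
  rw [add_comm]
  exact h4

/-- Lie brackets of related vector fields are related. -/
theorem fderiv_lieBracket_of_related {F : P → E} {X Y : E → E} {w z : P → P} {V : Set P}
    (hV : IsOpen V) {p : P} (hp : p ∈ V) (hF : ContDiffAt ℝ 2 F p)
    (hX : DifferentiableAt ℝ X (F p)) (hY : DifferentiableAt ℝ Y (F p))
    (hw : DifferentiableAt ℝ w p) (hz : DifferentiableAt ℝ z p)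
    (h : ∀ q ∈ V, fderiv ℝ F q (w q) = X (F q)) (h' : ∀ q ∈ V, fderiv ℝ F q (z q) = Y (F q)) :
    fderiv ℝ F p (VectorField.lieBracket ℝ w z p) = VectorField.lieBracket ℝ X Y (F p) := by
  have h1 := fderiv_fderiv_apply_eq_of_related hV hp hF hX hw h (z p)
  have h2 := fderiv_fderiv_apply_eq_of_related hV hp hF hY hz h' (w p)
  have hs : IsSymmSndFDerivAt ℝ F p :=
    hF.isSymmSndFDerivAt (by rw [minSmoothness_of_isRCLikeNormedField])
  simp only [VectorField.lieBracket_eq]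
  rw [map_sub, ← h p hp, ← h' p hp, ← h1,
    ← h2, hs.eq (z p) (w p)]
  abel

/-- A map of full rank lifts the vector fields tangent to it, smoothly. -/
theorem exists_smooth_lift [FiniteDimensional ℝ E] [CompleteSpace P] {F : P → E} {V : Set P} (hV : IsOpen V)
    (hF : ContDiffOn ℝ ∞ F V) {p₀ : P} (hp₀ : p₀ ∈ V)
    (hinj : Function.Injective (fderiv ℝ F p₀)) :
    ∃ V' ⊆ V, IsOpen V' ∧ p₀ ∈ V' ∧ ∀ X : E → E, ContDiffOn ℝ ∞ (X ∘ F) V →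
      (∀ p ∈ V, X (F p) ∈ Set.range (fderiv ℝ F p)) →
        ∃ w : P → P, ContDiffOn ℝ ∞ w V' ∧ ∀ p ∈ V', fderiv ℝ F p (w p) = X (F p) := by
  obtain ⟨L, hL⟩ := (fderiv ℝ F p₀).toLinearMap.exists_leftInverse_of_injective
    (LinearMap.ker_eq_bot.2 hinj)
  let L' : E →L[ℝ] P := L.toContinuousLinearMap
  have hL' : L' ∘L fderiv ℝ F p₀ = ContinuousLinearMap.id ℝ P := by
    ext q; exact DFunLike.congr_fun hL q
  have hdF : ContDiffOn ℝ ∞ (fun p => L' ∘L fderiv ℝ F p) V :=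
    contDiffOn_const.clm_comp (hF.fderiv_of_isOpen hV (by simp))
  -- `L'` is a left inverse of the derivative at `p₀`, so `L' ∘ DF p` is invertible near `p₀`. This
  -- neighbourhood does not depend on `X`, hence lifts of different fields share a domain and can be
  -- bracketed.
  refine ⟨V ∩ (fun p => L' ∘L fderiv ℝ F p) ⁻¹' Set.range ((↑) : (P ≃L[ℝ] P) → P →L[ℝ] P),
    Set.inter_subset_left, hdF.continuousOn.isOpen_inter_preimage hV (ContinuousLinearEquiv.isOpen),
    ⟨hp₀, ContinuousLinearEquiv.refl ℝ P, ?_⟩, ?_⟩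
  · simp only [hL']; rfl
  · intro X hX hr
    -- `(L' ∘ DF p)⁻¹ ∘ L'` is a left inverse of `DF p` that varies smoothly with `p`.
    refine ⟨fun p => (L' ∘L fderiv ℝ F p).inverse (L' (X (F p))), ?_, ?_⟩
    · rintro p ⟨hp, T, hT⟩
      have h1 : ContDiffAt ℝ ∞ (fun p => (L' ∘L fderiv ℝ F p).inverse) p := by
        have h2 : ContDiffAt ℝ ∞ (ContinuousLinearMap.inverse : (P →L[ℝ] P) → P →L[ℝ] P)
          (L' ∘L fderiv ℝ F p) :=
          ContinuousLinearMap.IsInvertible.contDiffAt_map_inverse ⟨T, hT⟩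
        exact h2.comp p (hdF.contDiffAt (hV.mem_nhds hp))
      exact (h1.clm_apply (contDiffAt_const.clm_apply
        (hX.contDiffAt (hV.mem_nhds hp)))).contDiffWithinAt
    · rintro p ⟨hp, T, hT⟩
      obtain ⟨q, hq⟩ := hr p hp
      have h3 : L' (X (F p)) = T q := by
        rw [← hq]; exact (DFunLike.congr_fun hT q).symm
      simp only at hT ⊢
      rw [← hT, ContinuousLinearMap.inverse_equiv, h3]
      change fderiv ℝ F p (T.symm (T q)) = _
      rw [T.symm_apply_apply, hq]

end Related

/-! ### Tangency of the generated Lie algebra. -/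

section Tangent

variable {n k : ℕ} {M : Type*} [TopologicalSpace M]
  [ChartedSpace (EuclideanSpace ℝ (Fin n)) M] [IsManifold (𝓡 n) ∞ M]
  {e : OpenPartialHomeomorph M (EuclideanSpace ℝ (Fin n))}
  {P : Type*} [NormedAddCommGroup P] [NormedSpace ℝ P]

/-- The vector fields that lift smoothly along a map. -/
def liftable (he : e ∈ atlas (EuclideanSpace ℝ (Fin n)) M) {F : P → EuclideanSpace ℝ (Fin n)}
    {V : Set P} (hV : IsOpen V) (hF : ContDiffOn ℝ ∞ F V) (hm : Set.MapsTo F V e.target) :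
    LieSubalgebra ℝ (SmoothVectorField n M) where
  carrier := {v | ∃ w : P → P, ContDiffOn ℝ ∞ w V ∧
    ∀ p ∈ V, fderiv ℝ F p (w p) = chartField e v (F p)}
  add_mem' := by
    rintro v v' ⟨w, hw, h⟩ ⟨w', hw', h'⟩
    refine ⟨w + w', hw.add hw', fun p hp => ?_⟩
    rw [chartField_add, Pi.add_apply, Pi.add_apply, map_add, h p hp, h' p hp]
  zero_mem' := ⟨0, contDiffOn_const, fun p hp => by simp [chartField_zero]⟩
  smul_mem' := by
    rintro c v ⟨w, hw, h⟩
    refine ⟨c • w, hw.const_smul c, fun p hp => ?_⟩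
    rw [chartField_smul, Pi.smul_apply, Pi.smul_apply, map_smul, h p hp]
  lie_mem' := by
    rintro v v' ⟨w, hw, h⟩ ⟨w', hw', h'⟩
    refine ⟨VectorField.lieBracket ℝ w w', fun p hp => ?_, fun p hp => ?_⟩
    · have hV' := hV.mem_nhds hp
      exact (ContDiffAt.lieBracket_vectorField (m := ∞) (hw.contDiffAt hV') (hw'.contDiffAt hV')
        (by simp)).contDiffWithinAt
    · have hV' := hV.mem_nhds hp
      have ht := e.open_target.mem_nhds (hm hp)
      rw [chartField_bracket he v v' (hm hp)]
      exact fderiv_lieBracket_of_related hV hp ((hF.contDiffAt hV').of_le (by exact ENat.LEInfty.out))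
        (((contDiffOn_chartField he v).contDiffAt ht).differentiableAt (by simp))
        (((contDiffOn_chartField he v').contDiffAt ht).differentiableAt (by simp))
        ((hw.contDiffAt hV').differentiableAt (by simp))
        ((hw'.contDiffAt hV').differentiableAt (by simp)) h h'

/-- If the fields `u l` are tangent to an immersed submanifold, so are those of the Lie algebra
they generate. -/
theorem chartField_mem_range_of_mem_lieHull [CompleteSpace P]
    (he : e ∈ atlas (EuclideanSpace ℝ (Fin n)) M)
    {F : P → EuclideanSpace ℝ (Fin n)} {V : Set P} (hV : IsOpen V) (hF : ContDiffOn ℝ ∞ F V)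
    (hm : Set.MapsTo F V e.target) {p₀ : P} (hp₀ : p₀ ∈ V)
    (hinj : Function.Injective (fderiv ℝ F p₀)) {u : Fin k → SmoothVectorField n M}
    (hu : ∀ l, ∀ p ∈ V, chartField e (u l) (F p) ∈ Set.range (fderiv ℝ F p))
    {v : SmoothVectorField n M} (hv : v ∈ lieHull u) :
    chartField e v (F p₀) ∈ Set.range (fderiv ℝ F p₀) := by
  obtain ⟨V', hV'V, hV', hp₀', hlift⟩ := exists_smooth_lift hV hF hp₀ hinj
  -- The liftable fields form a Lie algebra; it contains the generators, hence everything they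
  -- generate.
  have hle : lieHull u ≤ liftable he hV' (hF.mono hV'V) (hm.mono_left hV'V) := by
    refine LieSubalgebra.lieSpan_le.2 ?_
    rintro _ ⟨l, rfl⟩
    exact hlift _ ((contDiffOn_chartField he (u l)).comp hF hm) (hu l)
  obtain ⟨w, -, h⟩ := hle hv
  exact ⟨w p₀, h p₀ hp₀'⟩

/-- Condition A enters only through the span of the full Lie algebra: the segments have freely
varying lengths, and the total elapsed time need not be fixed. -/
theorem zeroHull_le_lieHull (u : Fin k → SmoothVectorField n M) :
    zeroHull u ≤ (lieHull u).toSubmodule := by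
  rintro _ ⟨v, hv, c, -, rfl⟩
  have h1 : derivedHull u ≤ lieHull u := by
    refine LieSubalgebra.lieSpan_le.2 ?_
    rintro _ ⟨v₁, h₁, v₂, h₂, rfl⟩
    exact (lieHull u).lie_mem h₁ h₂
  refine add_mem (h1 hv) (sum_mem fun l _ => Submodule.smul_mem _ _ ?_)
  exact LieSubalgebra.subset_lieSpan ⟨l, rfl⟩

/-- Condition A at a point provides a frame of elements of the Lie algebra near that point. -/
theorem ConditionA.exists_frame {u : Fin k → SmoothVectorField n M} {η : M}
    (hA : ConditionA u η) (he : e ∈ atlas (EuclideanSpace ℝ (Fin n)) M) (hη : η ∈ e.source) :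
    ∃ U, IsOpen U ∧ e η ∈ U ∧ U ⊆ e.target ∧ ∃ b : Fin n → SmoothVectorField n M,
      (∀ a, b a ∈ lieHull u) ∧ ∀ y ∈ U, LinearIndependent ℝ fun a => chartField e (b a) y := by
  have : FiniteDimensional ℝ (TangentSpace (𝓡 n) η) :=
    inferInstanceAs (FiniteDimensional ℝ (EuclideanSpace ℝ (Fin n)))
  let c := Module.finBasisOfFinrankEq ℝ ((zeroHull u).map (evalAt η)) hA
  choose b hb hbc using fun a => Submodule.mem_map.1 (c a).2
  have hli : LinearIndependent ℝ fun a => b a η := by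
    have h := c.linearIndependent.map' (Submodule.subtype _) (Submodule.ker_subtype _)
    have h' : (fun a => b a η) = Submodule.subtype _ ∘ c := funext hbc
    rw [h']
    exact h
  have h0 : LinearIndependent ℝ fun a => chartField e (b a) (e η) := by
    have hy := e.map_source hη
    refine LinearIndependent.of_comp (mfderiv (𝓡 n) (𝓡 n) e.symm (e η)).toLinearMap ?_
    have h2 : ∀ a, mfderiv (𝓡 n) (𝓡 n) e.symm (e η) (chartField e (b a) (e η)) = b a η := by
      intro a
      rw [mfderiv_chart_symm_chartField he _ hy, e.left_inv hη]
    have h3 : LinearIndependent ℝ (fun a => (b a (e.symm (e η)))) := by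
      rw [e.left_inv hη]; exact hli
    convert h3 using 2 with a
    exact mfderiv_chart_symm_chartField he _ hy
  have hcont : ContinuousOn (fun y a => chartField e (b a) y) e.target :=
    continuousOn_pi.2 fun a => (contDiffOn_chartField he (b a)).continuousOn
  exact ⟨_, hcont.isOpen_inter_preimage e.open_target isOpen_setOfPred_linearIndependent,
    ⟨e.map_source hη, h0⟩, Set.inter_subset_left, b,
    fun a => zeroHull_le_lieHull u (hb a), fun y hy => hy.2⟩

end Tangent

/-! ### Adding a dimension to an immersed submanifold. -/

section Extend

variable {n : ℕ} {M : Type*} [TopologicalSpace M] [T2Space M]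
  [ChartedSpace (EuclideanSpace ℝ (Fin n)) M] [IsManifold (𝓡 n) ∞ M]
  {e : OpenPartialHomeomorph M (EuclideanSpace ℝ (Fin n))}
  {P : Type*} [NormedAddCommGroup P] [NormedSpace ℝ P] [FiniteDimensional ℝ P]

/-- Flowing an immersed submanifold along `v` for a short time, and then along a vector field `w`
that is transverse to it, produces immersed submanifolds of one dimension more. -/
theorem exists_extended_immersion (he : e ∈ atlas (EuclideanSpace ℝ (Fin n)) M)
    {v w : SmoothVectorField n M} (hv : IsForwardComplete v) (hw : IsForwardComplete w)
    {U : Set (EuclideanSpace ℝ (Fin n))} (hU : IsOpen U) (hUe : U ⊆ e.target)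
    {F : P → EuclideanSpace ℝ (Fin n)} {V : Set P} (hV : IsOpen V) (hF : ContDiffOn ℝ ∞ F V)
    (hm : Set.MapsTo F V U) {p₁ : P} (hp₁ : p₁ ∈ V) (hinj : Function.Injective (fderiv ℝ F p₁))
    (htr : chartField e w (F p₁) ∉ Set.range (fderiv ℝ F p₁)) :
    ∃ ε > 0, ∃ B : Set (P × ℝ), IsOpen B ∧ (p₁, 0) ∈ B ∧
      ∃ H : ℝ → P × ℝ → EuclideanSpace ℝ (Fin n), ∀ s, 0 < s → s < ε →
        ContDiffOn ℝ ∞ (H s) B ∧ (∀ q ∈ B, Function.Injective (fderiv ℝ (H s) q)) ∧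
        Set.MapsTo (H s) B U ∧ ∀ q ∈ B, q.1 ∈ V ∧
          (0 ≤ q.2 → flow w q.2 (flow v s (e.symm (F q.1))) = e.symm (H s q)) := by
  obtain ⟨O₁, hO₁, hmem₁, Ψ₁, hs₁, hz₁, ht₁, hf₁⟩ :=
    exists_localFlow_chart hv he (hUe (hm hp₁))
  obtain ⟨O₂, hO₂, hmem₂, Ψ₂, hs₂, hz₂, ht₂, hf₂⟩ :=
    exists_localFlow_chart hw he (hUe (hm hp₁))
  let W₀ : Set (ℝ × P × ℝ) := {z | z.2.1 ∈ V}
  have hW₀ : IsOpen W₀ := hV.preimage (by fun_prop)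
  have hF₀ : ContDiffOn ℝ ∞ (fun z : ℝ × P × ℝ => (z.1, F z.2.1)) W₀ :=
    contDiffOn_fst.prodMk (hF.comp (by fun_prop) fun z hz => hz)
  let W₁ : Set (ℝ × P × ℝ) := W₀ ∩ (fun z => (z.1, F z.2.1)) ⁻¹' O₁
  have hW₁ : IsOpen W₁ := hF₀.continuousOn.isOpen_inter_preimage hW₀ hO₁
  have hF₁ : ContDiffOn ℝ ∞ (fun z : ℝ × P × ℝ => (z.2.2, Ψ₁ (z.1, F z.2.1))) W₁ :=
    ContDiffOn.prodMk (by fun_prop) (hs₁.comp (hF₀.mono Set.inter_subset_left) fun z hz => hz.2)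
  let W₂ : Set (ℝ × P × ℝ) := W₁ ∩ (fun z => (z.2.2, Ψ₁ (z.1, F z.2.1))) ⁻¹' O₂
  have hW₂ : IsOpen W₂ := hF₁.continuousOn.isOpen_inter_preimage hW₁ hO₂
  -- The flow along `v` for time `s` represents the stay in the current regime, followed by time `r`
  -- along `w`. At `s = r = 0` the derivative in `(p, r)` is `(a, r) ↦ DF a + r w`, injective by
  -- transversality; injectivity is an open condition and persists for small `s > 0`.
  let H : ℝ × P × ℝ → EuclideanSpace ℝ (Fin n) := fun z => Ψ₂ (z.2.2, Ψ₁ (z.1, F z.2.1))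
  have hH₂ : ContDiffOn ℝ ∞ H W₂ := hs₂.comp (hF₁.mono Set.inter_subset_left) fun z hz => hz.2
  let W₃ := W₂ ∩ H ⁻¹' U
  have hW₃ : IsOpen W₃ := hH₂.continuousOn.isOpen_inter_preimage hW₂ hU
  have hH : ContDiffOn ℝ ∞ H W₃ := hH₂.mono Set.inter_subset_left
  let D : ℝ × P × ℝ → (P × ℝ →L[ℝ] EuclideanSpace ℝ (Fin n)) := fun z =>
    fderiv ℝ H z ∘L ContinuousLinearMap.inr ℝ ℝ (P × ℝ)
  have hDc : ContinuousOn D W₃ :=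
    (hH.continuousOn_fderiv_of_isOpen hW₃ (by simp)).clm_comp continuousOn_const
  have hDd : ∀ z ∈ W₃, HasFDerivAt (fun q => H (z.1, q)) (D z) z.2 := by
    intro z hz
    have h1 := ((hH.contDiffAt (hW₃.mem_nhds hz)).differentiableAt (by simp)).hasFDerivAt
    have h2 : HasFDerivAt (fun q : P × ℝ => (z.1, q)) (ContinuousLinearMap.inr ℝ ℝ (P × ℝ)) z.2 :=
      hasFDerivAt_prodMk_right z.1 z.2
    exact h1.comp (f := fun q : P × ℝ => (z.1, q)) z.2 h2
  let z₀ : ℝ × P × ℝ := (0, p₁, 0)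
  have hΨ₁ : Ψ₁ (0, F p₁) = F p₁ := (hz₁ _ hmem₁).1
  have hΨ₂ : Ψ₂ (0, F p₁) = F p₁ := (hz₂ _ hmem₂).1
  have hz₀ : z₀ ∈ W₃ := by
    refine ⟨⟨⟨hp₁, hmem₁⟩, ?_⟩, ?_⟩
    · change (0, Ψ₁ (0, F p₁)) ∈ O₂
      rw [hΨ₁]; exact hmem₂
    · change Ψ₂ (0, Ψ₁ (0, F p₁)) ∈ U
      rw [hΨ₁, hΨ₂]; exact hm hp₁
  have hD1 : ∀ a : P, D z₀ (a, 0) = fderiv ℝ F p₁ a := by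
    have h1 : HasFDerivAt (fun p : P => H (0, p, 0)) (D z₀ ∘L ContinuousLinearMap.inl ℝ P ℝ) p₁ :=
      (hDd z₀ hz₀).comp (f := fun p : P => (p, (0 : ℝ))) p₁ (hasFDerivAt_prodMk_left p₁ (0 : ℝ))
    have h2 : (fun p : P => H (0, p, 0)) =ᶠ[𝓝 p₁] F := by
      have hc : ContinuousAt (fun p => ((0 : ℝ), F p)) p₁ :=
        continuousAt_const.prodMk (hF.continuousOn.continuousAt (hV.mem_nhds hp₁))
      filter_upwards [hc.preimage_mem_nhds (hO₁.mem_nhds hmem₁),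
        hc.preimage_mem_nhds (hO₂.mem_nhds hmem₂)] with p h₁ h₂
      change Ψ₂ (0, Ψ₁ (0, F p)) = F p
      rw [(hz₁ _ h₁).1, (hz₂ _ h₂).1]
    intro a
    rw [(h1.congr_of_eventuallyEq h2.symm).fderiv]
    rfl
  have hD2 : D z₀ (0, 1) = chartField e w (F p₁) := by
    have h1 : HasFDerivAt (fun r : ℝ => H (0, p₁, r)) (D z₀ ∘L ContinuousLinearMap.inr ℝ P ℝ) 0 :=
      (hDd z₀ hz₀).comp (f := fun r : ℝ => (p₁, r)) (0 : ℝ) (hasFDerivAt_prodMk_right p₁ (0 : ℝ))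
    have h2 : HasDerivAt (fun r : ℝ => H (0, p₁, r)) (chartField e w (F p₁)) 0 := by
      have := (hz₂ _ hmem₂).2
      change HasDerivAt (fun r : ℝ => Ψ₂ (r, Ψ₁ (0, F p₁))) _ 0
      rwa [hΨ₁]
    exact h1.hasDerivAt.unique h2
  have hDinj : Function.Injective (D z₀) := by
    rw [injective_iff_map_eq_zero]
    rintro ⟨a, r⟩ h
    have h1 : D z₀ (a, r) = fderiv ℝ F p₁ a + r • chartField e w (F p₁) := by
      rw [← hD1, ← hD2, ← map_smul, ← map_add]
      simp
    rw [h1] at h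
    have hr : r = 0 := by
      by_contra hr
      refine htr ⟨-(r⁻¹ • a), ?_⟩
      rw [map_neg, map_smul, eq_neg_of_add_eq_zero_left h, smul_neg, neg_neg, smul_smul,
        inv_mul_cancel₀ hr, one_smul]
    subst hr
    rw [zero_smul, add_zero] at h
    rw [(injective_iff_map_eq_zero _).1 hinj a h]
    rfl
  have hW₄ : IsOpen (W₃ ∩ D ⁻¹' {A | Function.Injective A}) :=
    hDc.isOpen_inter_preimage hW₃ ContinuousLinearMap.isOpen_injective
  obtain ⟨I, hI, B, hB, hIB⟩ := mem_nhds_prod_iff.1 (hW₄.mem_nhds ⟨hz₀, hDinj⟩)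
  obtain ⟨ε, hε, hεI⟩ := Metric.mem_nhds_iff.1 hI
  obtain ⟨B', hB', hB'o, hB'm⟩ := mem_nhds_iff.1 hB
  refine ⟨ε, hε, B', hB'o, hB'm, fun s q => H (s, q), fun s hs hsε => ?_⟩
  have hmem : ∀ q ∈ B', (s, q) ∈ W₃ ∩ D ⁻¹' {A | Function.Injective A} := fun q hq =>
    hIB ⟨hεI (by rw [Metric.mem_ball, Real.dist_eq, sub_zero, abs_of_pos hs]; exact hsε), hB' hq⟩
  refine ⟨hH.comp (by fun_prop) fun q hq => (hmem q hq).1, fun q hq => ?_,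
    fun q hq => (hmem q hq).1.2, fun q hq => ⟨(hmem q hq).1.1.1.1, fun hr => ?_⟩⟩
  · rw [(hDd _ (hmem q hq).1).fderiv]
    exact (hmem q hq).2
  · have h := (hmem q hq).1.1
    rw [hf₁ s _ h.1.2 hs.le, hf₂ q.2 _ h.2 hr]

end Extend

/-! ### Growing patches inside an absorbing set. -/

section Patch

variable {n k : ℕ} {M : Type*} [TopologicalSpace M]
  {e : OpenPartialHomeomorph M (EuclideanSpace ℝ (Fin n))}
  {U : Set (EuclideanSpace ℝ (Fin n))} {G : Set (M × Fin k)} {j : Fin k}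
  {P : Type*} [NormedAddCommGroup P] [NormedSpace ℝ P] [MeasurableSpace P]

/-- A parametrized immersed submanifold of `U`, read in the chart `e`, almost all of whose points
belong to `G` together with the regime `j`. -/
structure IsPatch (e : OpenPartialHomeomorph M (EuclideanSpace ℝ (Fin n)))
    (U : Set (EuclideanSpace ℝ (Fin n))) (G : Set (M × Fin k)) (j : Fin k) (ν : Measure P)
    (F : P → EuclideanSpace ℝ (Fin n)) (V : Set P) : Prop where
  isOpen : IsOpen V
  nonempty : V.Nonempty
  contDiffOn : ContDiffOn ℝ ∞ F V
  injective : ∀ p ∈ V, Function.Injective (fderiv ℝ F p)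
  mapsTo : Set.MapsTo F V U
  ae_mem : ∀ᵐ p ∂ν, p ∈ V → (e.symm (F p), j) ∈ G

/-- Haar measures on the same space are equivalent, so a linear change of parameters keeps the
almost everywhere condition. It returns the parameter space `P × ℝ` to a Euclidean one. -/
theorem IsPatch.comp_equiv {P' : Type*} [NormedAddCommGroup P'] [NormedSpace ℝ P']
    [FiniteDimensional ℝ P] [FiniteDimensional ℝ P']
    [MeasurableSpace P'] [BorelSpace P] [BorelSpace P'] {ν : Measure P} {ν' : Measure P'}
    [ν.IsAddHaarMeasure] [ν'.IsAddHaarMeasure] {F : P → EuclideanSpace ℝ (Fin n)} {V : Set P}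
    (h : IsPatch e U G j ν F V) (T : P' ≃L[ℝ] P) : IsPatch e U G j ν' (F ∘ T) (T ⁻¹' V) where
  isOpen := h.isOpen.preimage T.continuous
  nonempty := h.nonempty.preimage T.surjective
  contDiffOn := h.contDiffOn.comp T.contDiff.contDiffOn fun _ hp => hp
  injective p hp := by
    rw [T.comp_right_fderiv]
    exact (h.injective (T p) hp).comp T.injective
  mapsTo _ hp := h.mapsTo hp
  ae_mem := by
    have : (ν'.map T).IsAddHaarMeasure := T.isAddHaarMeasure_map ν'
    have h1 : ν'.map T ≪ ν := Measure.absolutelyContinuous_isAddHaarMeasure _ _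
    exact ae_of_ae_map T.continuous.aemeasurable (h1.ae_le h.ae_mem)

variable [ChartedSpace (EuclideanSpace ℝ (Fin n)) M] [IsManifold (𝓡 n) ∞ M]

/-- If every `u l` were tangent throughout the patch, so would be the `n` independent fields of the
frame, but the tangent space has dimension less than `n`. -/
theorem IsPatch.exists_notMem_range [FiniteDimensional ℝ P] {ν : Measure P}
    {F : P → EuclideanSpace ℝ (Fin n)} {V : Set P} (h : IsPatch e U G j ν F V)
    (he : e ∈ atlas (EuclideanSpace ℝ (Fin n)) M) (hUe : U ⊆ e.target)
    {u : Fin k → SmoothVectorField n M} {b : Fin n → SmoothVectorField n M}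
    (hb : ∀ a, b a ∈ lieHull u)
    (hli : ∀ y ∈ U, LinearIndependent ℝ fun a => chartField e (b a) y)
    (hP : Module.finrank ℝ P < n) :
    ∃ p ∈ V, ∃ l, chartField e (u l) (F p) ∉ Set.range (fderiv ℝ F p) := by
  by_contra! hc
  obtain ⟨p, hp⟩ := h.nonempty
  have h1 : ∀ a, chartField e (b a) (F p) ∈ (fderiv ℝ F p).toLinearMap.range := fun a =>
    chartField_mem_range_of_mem_lieHull he h.isOpen h.contDiffOn (h.mapsTo.mono_right hUe) hp
      (h.injective p hp) (fun l p hp => hc p hp l) (hb a)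
  have h2 : Submodule.span ℝ (Set.range fun a => chartField e (b a) (F p)) ≤
      (fderiv ℝ F p).toLinearMap.range := by
    rw [Submodule.span_le]
    rintro _ ⟨a, rfl⟩
    exact h1 a
  have h3 := Submodule.finrank_mono h2
  rw [finrank_span_eq_card (hli _ (h.mapsTo hp)), Fintype.card_fin] at h3
  have h4 := (fderiv ℝ F p).toLinearMap.finrank_range_le
  omega

/-- By Fubini and the absorbing property, almost every holding time `s` in the old regime sends
almost all `(p, r)` into `G`. Fixing one such small `s` leaves `r` as the only new parameter. -/
theorem IsPatch.exists_extension [T2Space M] [MeasurableSpace M] [BorelSpace M]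
    [FiniteDimensional ℝ P] [BorelSpace P] {ν : Measure P} [SFinite ν]
    {F : P → EuclideanSpace ℝ (Fin n)} {V : Set P} (h : IsPatch e U G j ν F V)
    (he : e ∈ atlas (EuclideanSpace ℝ (Fin n)) M) (hU : IsOpen U) (hUe : U ⊆ e.target)
    {u : Fin k → SmoothVectorField n M} (hu : ∀ l, IsForwardComplete (u l))
    (hf : ∀ l, Measurable fun q : ℝ × M => flow (u l) q.1 q.2) (hG : MeasurableSet G)
    (habs : ∀ ξ i, (ξ, i) ∈ G → ∀ j, ∀ᵐ s ∂(volume.restrict (Set.Ioi (0 : ℝ))),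
      ∀ᵐ r ∂(volume.restrict (Set.Ioi (0 : ℝ))), (flow (u j) r (flow (u i) s ξ), j) ∈ G)
    {p₁ : P} (hp₁ : p₁ ∈ V) {l : Fin k}
    (htr : chartField e (u l) (F p₁) ∉ Set.range (fderiv ℝ F p₁)) :
    ∃ F' V', IsPatch e U G l (ν.prod (volume : Measure ℝ)) F' V' := by
  classical
  obtain ⟨ε, hε, B, hB, hpB, H, hH⟩ := exists_extended_immersion he (hu j) (hu l) hU hUe
    h.isOpen h.contDiffOn h.mapsTo hp₁ (h.injective p₁ hp₁) htr
  -- A measurable extension of the patch to all of `P`, as Fubini needs globally measurable sets.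
  let Θ : P → M := V.piecewise (e.symm ∘ F) fun _ => e.symm (F p₁)
  have hΘ : Measurable Θ := ContinuousOn.measurable_piecewise
    (e.continuousOn_symm.comp h.contDiffOn.continuousOn (h.mapsTo.mono_right hUe))
    continuousOn_const h.isOpen.measurableSet
  have hΘV : ∀ p ∈ V, Θ p = e.symm (F p) := fun p hp => Set.piecewise_eq_of_mem _ _ _ hp
  let Q : Set ((P × ℝ) × ℝ) :=
    {z | z.1.1 ∈ V → (flow (u l) z.2 (flow (u j) z.1.2 (Θ z.1.1)), l) ∈ G}
  have hmeas : Measurable fun z : (P × ℝ) × ℝ =>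
      (flow (u l) z.2 (flow (u j) z.1.2 (Θ z.1.1)), l) := by
    have h1 : Measurable fun z : (P × ℝ) × ℝ => flow (u j) z.1.2 (Θ z.1.1) :=
      (hf j).comp (f := fun z : (P × ℝ) × ℝ => (z.1.2, Θ z.1.1)) (by fun_prop)
    exact ((hf l).comp (f := fun z : (P × ℝ) × ℝ => (z.2, flow (u j) z.1.2 (Θ z.1.1)))
      (measurable_snd.prodMk h1)).prodMk measurable_const
  have hQ : MeasurableSet Q := by
    have h1 : MeasurableSet {z : (P × ℝ) × ℝ | z.1.1 ∈ V} :=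
      h.isOpen.measurableSet.preimage (by fun_prop)
    have h2 : Q = {z : (P × ℝ) × ℝ | z.1.1 ∈ V}ᶜ ∪ (fun z : (P × ℝ) × ℝ =>
      (flow (u l) z.2 (flow (u j) z.1.2 (Θ z.1.1)), l)) ⁻¹' G := by
      ext z
      exact imp_iff_not_or
    rw [h2]
    exact h1.compl.union (hmeas hG)
  have hae : ∀ᵐ p ∂ν, ∀ᵐ s ∂(volume.restrict (Set.Ioi (0 : ℝ))),
      ∀ᵐ r ∂(volume.restrict (Set.Ioi (0 : ℝ))), ((p, s), r) ∈ Q := by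
    filter_upwards [h.ae_mem] with p hp
    by_cases hpV : p ∈ V
    · filter_upwards [habs _ _ (hp hpV) l] with s hs
      filter_upwards [hs] with r hr _
      rw [← hΘV p hpV] at hr
      exact hr
    · exact .of_forall fun s => .of_forall fun r hV => absurd hV hpV
  have hmeas' : MeasurableSet {z : P × ℝ |
      ∀ᵐ r ∂(volume.restrict (Set.Ioi (0 : ℝ))), (z, r) ∈ Q} :=
    (measurable_measure_prodMk_left hQ.compl) (measurableSet_singleton 0)
  have hsp := (Measure.ae_ae_comm (p := fun p s =>
    ∀ᵐ r ∂(volume.restrict (Set.Ioi (0 : ℝ))), ((p, s), r) ∈ Q) hmeas').1 hae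
  obtain ⟨s, hs, hs0, hsε⟩ : ∃ s : ℝ, (∀ᵐ p ∂ν, ∀ᵐ r ∂(volume.restrict (Set.Ioi (0 : ℝ))),
      ((p, s), r) ∈ Q) ∧ 0 < s ∧ s < ε := by
    have h1 : ∀ᵐ s ∂(volume.restrict (Set.Ioo 0 ε)), _ := ae_mono
      (Measure.restrict_mono Set.Ioo_subset_Ioi_self le_rfl) hsp
    have h2 : (ae (volume.restrict (Set.Ioo 0 ε))).NeBot := by
      rw [ae_neBot, Ne, Measure.restrict_eq_zero, Real.volume_Ioo]
      simpa using hε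
    obtain ⟨s, hs, hs'⟩ := (h1.and (ae_restrict_mem measurableSet_Ioo)).exists
    exact ⟨s, hs, hs'⟩
  obtain ⟨hH1, hH2, hH3, hH4⟩ := hH s hs0 hsε
  have hprod : ∀ᵐ q ∂(ν.prod (volume.restrict (Set.Ioi (0 : ℝ)))), ((q.1, s), q.2) ∈ Q :=
    (Measure.ae_prod_iff_ae_ae (p := fun q : P × ℝ => ((q.1, s), q.2) ∈ Q)
      (hQ.preimage (by fun_prop))).2 hs
  -- The formula for `H s` agrees with the forward flow only for `r ≥ 0`. The point `(p₁, 0)` is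
  -- lost, but points with small `r > 0` remain.
  have hBpos : IsOpen (B ∩ {q | 0 < q.2}) := hB.inter (isOpen_lt continuous_const continuous_snd)
  refine ⟨H s, B ∩ {q | 0 < q.2}, hBpos, ?_, hH1.mono Set.inter_subset_left,
    fun q hq => hH2 q hq.1, hH3.mono_left Set.inter_subset_left, ?_⟩
  · have h1 : Filter.Tendsto (fun r : ℝ => (p₁, r)) (𝓝[>] 0) (𝓝 (p₁, 0)) :=
      (Continuous.tendsto (by fun_prop) (0 : ℝ)).mono_left nhdsWithin_le_nhds
    obtain ⟨r, hr, hr'⟩ :=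
      ((h1.eventually (hB.mem_nhds hpB)).and self_mem_nhdsWithin).exists
    exact ⟨(p₁, r), hr, hr'⟩
  · have h1 : ν.prod (volume.restrict (Set.Ioi (0 : ℝ)))
        = (ν.prod volume).restrict (Set.univ ×ˢ Set.Ioi (0 : ℝ)) := by
      rw [← Measure.prod_restrict, Measure.restrict_univ]
    rw [h1, ae_restrict_iff' (MeasurableSet.univ.prod measurableSet_Ioi)] at hprod
    filter_upwards [hprod] with q hq hqB
    obtain ⟨hqV, hfl⟩ := hH4 q hqB.1
    have h2 := hq ⟨trivial, hqB.2⟩ hqV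
    simp only [hΘV q.1 hqV] at h2
    rwa [hfl (le_of_lt hqB.2)] at h2

/-- Induction on the dimension, starting from the single point `y₀`. All patches stay in `U`, where
the frame is independent, so a transverse field exists at every stage. -/
theorem IsPatch.exists_patch_of_le [T2Space M] [MeasurableSpace M] [BorelSpace M]
    (he : e ∈ atlas (EuclideanSpace ℝ (Fin n)) M) (hU : IsOpen U) (hUe : U ⊆ e.target)
    {u : Fin k → SmoothVectorField n M} (hu : ∀ l, IsForwardComplete (u l))
    (hf : ∀ l, Measurable fun q : ℝ × M => flow (u l) q.1 q.2) (hG : MeasurableSet G)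
    (habs : ∀ ξ i, (ξ, i) ∈ G → ∀ j, ∀ᵐ s ∂(volume.restrict (Set.Ioi (0 : ℝ))),
      ∀ᵐ r ∂(volume.restrict (Set.Ioi (0 : ℝ))), (flow (u j) r (flow (u i) s ξ), j) ∈ G)
    {b : Fin n → SmoothVectorField n M} (hb : ∀ a, b a ∈ lieHull u)
    (hli : ∀ y ∈ U, LinearIndependent ℝ fun a => chartField e (b a) y)
    {y₀ : EuclideanSpace ℝ (Fin n)} (hy₀ : y₀ ∈ U) {i : Fin k} (hi : (e.symm y₀, i) ∈ G)
    {m : ℕ} (hmn : m ≤ n) :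
    ∃ j F V, IsPatch e U G j (volume : Measure (EuclideanSpace ℝ (Fin m))) F V := by
  induction m with
  | zero =>
    refine ⟨i, fun _ => y₀, Set.univ, isOpen_univ, Set.univ_nonempty, contDiffOn_const,
      fun p _ => Function.injective_of_subsingleton _, fun _ _ => hy₀, .of_forall fun _ _ => hi⟩
  | succ m ih =>
    obtain ⟨j, F, V, h⟩ := ih (Nat.le_of_succ_le hmn)
    obtain ⟨p, hp, l, htr⟩ := h.exists_notMem_range he hUe hb hli
      (by rw [finrank_euclideanSpace_fin]; exact hmn)
    obtain ⟨F', V', h'⟩ := h.exists_extension he hU hUe hu hf hG habs hp htr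
    have hd : Module.finrank ℝ (EuclideanSpace ℝ (Fin (m + 1)))
        = Module.finrank ℝ (EuclideanSpace ℝ (Fin m) × ℝ) := by simp
    exact ⟨l, _, _, h'.comp_equiv (ContinuousLinearEquiv.ofFinrankEq hd)⟩

end Patch

/-! ### Excluding the singular case. -/

/-- An invariant measure whose support meets Condition A is not carried by a Lebesgue null set. -/
theorem SwitchingSystem.IsInvariant.measure_compl_ne_zero {n k : ℕ} {M : Type*}
    [TopologicalSpace M] [T2Space M]
    [SecondCountableTopology M] [ChartedSpace (EuclideanSpace ℝ (Fin n)) M]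
    [IsManifold (𝓡 n) ∞ M] [MeasurableSpace M] [BorelSpace M]
    {lambdaM : Measure M} (hl : IsLebesgueMeasure n lambdaM)
    {sys : SwitchingSystem n k M} {μ : Measure (M × Fin k)} [IsProbabilityMeasure μ]
    (hμ : sys.IsInvariant μ) {η : M} {i : Fin k} (hsupp : (η, i) ∈ μ.support)
    (hA : ConditionA sys.field η) {N : Set (M × Fin k)} (hN : MeasurableSet N)
    (hN0 : ∀ j, lambdaM {ξ | (ξ, j) ∈ N} = 0) : μ Nᶜ ≠ 0 := by
  intro hμN
  have hf := sys.measurable_flow hl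
  obtain ⟨G, hGN, hG, hG0, habs⟩ := sys.exists_absorbing_subset hf hμ hN hμN
  have he := chart_mem_atlas (EuclideanSpace ℝ (Fin n)) η
  set e := chartAt (EuclideanSpace ℝ (Fin n)) η
  have hηe : η ∈ e.source := mem_chart_source _ η
  obtain ⟨U, hU, hηU, hUe, b, hb, hli⟩ := hA.exists_frame he hηe
  -- Every neighbourhood of a support point has positive measure, so it meets the full set `G`; the
  -- regime found there need not be `i`.
  obtain ⟨⟨ξ, i'⟩, ⟨⟨hξe, hξU⟩, -⟩, hξG⟩ : (((e.source ∩ e ⁻¹' U) ×ˢ Set.univ) ∩ G).Nonempty := by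
    by_contra hempty
    have h1 : (e.source ∩ e ⁻¹' U) ×ˢ Set.univ ⊆ Gᶜ := fun x hx hxG => hempty ⟨x, hx, hxG⟩
    have h2 := (Measure.mem_support_iff_forall _).1 hsupp _
      (((e.continuousOn.isOpen_inter_preimage e.open_source hU).prod isOpen_univ).mem_nhds
        ⟨⟨hηe, hηU⟩, Set.mem_univ i⟩)
    exact h2.ne' (measure_mono_null h1 hG0)
  obtain ⟨j, F, V, h⟩ := IsPatch.exists_patch_of_le he hU hUe sys.forwardComplete hf hG habs hb hli
    hξU (i := i') (by rwa [e.left_inv hξe]) le_rfl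
  -- In dimension `n` the patch is a local diffeomorphism, so the parameters sent into `N` form a
  -- null set; yet almost all parameters in `V` are sent into `G ⊆ N`.
  have hnull : volume (V ∩ F ⁻¹' (e '' ({ξ | (ξ, j) ∈ N} ∩ e.source))) = 0 :=
    addHaar_inter_preimage_eq_zero volume h.isOpen (h.contDiffOn.of_le (by simp)) h.injective
      ((hl.null_iff_of_subset_source he Set.inter_subset_right).1
        (measure_mono_null Set.inter_subset_left (hN0 j)))
  have hV : volume V = 0 := by
    refine (measure_eq_zero_iff_ae_notMem).2 ?_
    filter_upwards [h.ae_mem, measure_eq_zero_iff_ae_notMem.1 hnull] with p hp hp' hpV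
    have ht := hUe (h.mapsTo hpV)
    exact hp' ⟨hpV, e.symm (F p), ⟨hGN (hp hpV), e.map_target ht⟩, e.right_inv ht⟩
  exact (h.isOpen.measure_pos volume h.nonempty).ne' hV

end Switching

end

theorem theorem6 {n k : ℕ} {M : Type*} [TopologicalSpace M] [T2Space M]
    [SecondCountableTopology M] [ChartedSpace (EuclideanSpace ℝ (Fin n)) M]
    [IsManifold (𝓡 n) ∞ M] [MeasurableSpace M] [BorelSpace M]
    (lambdaM : Measure M) (hlambdaM : Switching.IsLebesgueMeasure n lambdaM)
    (sys : Switching.SwitchingSystem n k M)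
    (μ : Measure (M × Fin k)) (hμ : sys.IsErgodic μ)
    (η : M) (i : Fin k) (hsupp : (η, i) ∈ μ.support) (hA : Switching.ConditionA sys.field η) :
    μ ≪ lambdaM.prod (Measure.count : Measure (Fin k)) := by
  have := hμ.isProbabilityMeasure
  rcases hμ.absolutelyContinuous_or_singular hlambdaM with h | ⟨N, hN, hN0, hμN⟩
  · exact h
  · exact absurd hμN (hμ.isInvariant.measure_compl_ne_zero hlambdaM hsupp hA hN hN0)
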